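/- **Model.** There are $N$ base stations with measurable cells $\mathcal C_1,\dots,\mathcal C_N\subset\mathbb R^2$ of finite area, and $M$ contents. Requests for content $i$ form a homogeneous Poisson point process of intensity $\lambda_i\ge 0$ in space (inside $\bigcup_j\mathcal C_j$) and time $\tau>0$; the processes of different contents are independent. Each base station stores exactly $K$ contents, $K<M$; $\mathcal B$ is the finite set of placements, i.e. of matrices $B\in\{0,1\}^{M\times N}$ with all column sums $K$. For $B\in\mathcal B$ let $h(B)=\mathbf E(H_B)$, where $H_B$ is the number of requests in unit time that are for a content stored, under $B$, at some base station whose cell contains the place of the request. Let $\Delta=\max_{\mathcal B}h-\min_{\mathcal B}h$, and for $\beta\ge0$ let $\pi_\beta(B)=e^{\beta h(B)}/\sum_{B'\in\mathcal B}e^{\beta h(B')}$; write $\pi_\beta(\cdot\mid B_{\cdot,-j})$ for the conditional distribution under $\pi_\beta$ given all columns except column $j$. **Virtual caches.** Let $\beta_0>0$ satisfy $\beta_0N\Delta<1$ and $\beta_0\max_{B\in\mathcal B}h(B)<1$. $V(0)\in\mathcal B$ is arbitrary. At each time $t=1,2,\dots$ a base station $j_t$ is chosen uniformly from $\{1,\dots,N\}$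 and then, given the past, $V(t)$ is drawn from $\pi_{\beta_t}(\cdot\mid V_{\cdot,-j_t}(t-1))$, where $\beta_t=\beta_0\log(1+l)$ for $lN\le t\le lN+N-1$. Put $V(\tau)=V(t)$ for real $\tau\in[t,t+1)$, and $V(0-)=V(0)$. **Real caches.** Let $0<T_1\le T_2\le\cdots$ with $T_k\to\infty$, $S_0=0$, $S_l=T_1+\dots+T_l$, and let $\zeta(\tau)$ be the largest $S_l$, $l\ge0$, with $S_l\le\tau$. $R(0)\in\mathcal B$ is arbitrary, and $R$ changes only at requests. A request for content $i$ at time $\tau$ from a point $x$ goes to one base station $j$ with $x\in\mathcal C_j$, which has content $i$ in its real cache if some base station covering $x$ has. If $j$ has content $i$ in its real cache, or if $V_{i,j}(\zeta(\tau)-)=0$, nothing changes. Otherwise $j$ stores content $i$ in its real cache and removes from it some content $k\ne i$ with $V_{k,j}(\zeta(\tau)-)=0$. The choices of $j$ and $k$ among the admissible ones are arbitrary. **Theorem.** Assume that $|\mathcal C_i\cap(\bigcup_{j\ne i}\mathcal C_j)^c|>0$ for every $i\in\{1,\dots,N\}$, where $|\cdot|$ denotes area. Then $$\lim_{T\to\infty}\frac1T\int_0^T\mathbf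 P\Big(R(\tau)\in\arg\max_{B\in\mathcal B}h(B)\Big)\,d\tau=1,$$ and hence $$\lim_{T\to\infty}\frac1T\int_0^T\mathbf E\big(h(R(\tau))\big)\,d\tau=\max_{B\in\mathcal B}h(B).$$ -/

import Mathlib

open MeasureTheory ProbabilityTheory Filter Topology
open scoped NNReal ENNReal

/-- The two-dimensional Euclidean space. -/
abbrev Plane : Type := EuclideanSpace ℝ (Fin 2)

/-- A feasible placement `B` of contents in the caches of the network: the cache of each of the
`N` base stations holds exactly `K` of the `M` contents. `i ∈ (B j).1` means `B_{i,j} = 1`. -/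
def Config (M N K : ℕ) : Type := Fin N → {c : Finset (Fin M) // c.card = K}

namespace Config

instance (M N K : ℕ) : Fintype (Config M N K) :=
  inferInstanceAs (Fintype (Fin N → {c : Finset (Fin M) // c.card = K}))

instance (M N K : ℕ) : MeasurableSpace (Config M N K) := ⊤

/-- Content `i` is stored in the cache of base station `j`. -/
def Has {M N K : ℕ} (B : Config M N K) (i : Fin M) (j : Fin N) : Prop := i ∈ (B j).1

/-- `A` and `B` agree in all caches except possibly that of base station `j`. -/
def AgreeOff {M N K : ℕ} (j : Fin N) (A B : Config M N K) : Prop := ∀ n, n ≠ j → A n = B n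

instance {M N K : ℕ} (j : Fin N) (A B : Config M N K) : Decidable (AgreeOff j A B) :=
  have (n : Fin N) : Decidable (A n = B n) :=
    inferInstanceAs (Decidable ((A n : {c : Finset (Fin M) // c.card = K}) = B n))
  inferInstanceAs (Decidable (∀ n, n ≠ j → A n = B n))

end Config

noncomputable section

/-! ### The request process -/

/-- The random set `X` is a Poisson point process with (diffuse) intensity measure `ν`: the number
of points in a measurable set of finite intensity is Poisson distributed with that mean, and the
numbers of points in disjoint sets are independent. -/
structure IsPoissonPointProcess {Ω α : Type*} [MeasurableSpace Ω] [MeasurableSpace α]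
    (P : Measure Ω) (X : Ω → Set α) (ν : Measure α) : Prop where
  measurable_count : ∀ A : Set α, MeasurableSet A → Measurable fun ω => (X ω ∩ A).encard
  law_count : ∀ A : Set α, MeasurableSet A → ν A ≠ ∞ → ∀ n : ℕ,
    P {ω | (X ω ∩ A).encard = n} = poissonMeasure (ν A).toNNReal {n}
  indep_count : ∀ (m : ℕ) (A : Fin m → Set α), (∀ k, MeasurableSet (A k)) →
    (∀ k l, k ≠ l → Disjoint (A k) (A l)) → iIndepFun (fun k ω => (X ω ∩ A k).encard) P

/-- The σ-algebra generated by a point process, that is, by its numbers of points in measurable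
sets. -/
@[reducible]
def pointSigma {Ω α : Type*} [MeasurableSpace α] (X : Ω → Set α) : MeasurableSpace Ω :=
  ⨆ (A : Set α) (_ : MeasurableSet A), MeasurableSpace.comap (fun ω => (X ω ∩ A).encard) ⊤

/-- The requests: `(x, τ) ∈ Q i ω` means that content `i` is requested at time `τ` by a user at the
point `x`. The requests for content `i` form a homogeneous Poisson point process of intensity
`lam i` in space (inside the union of the cells `C j`) and time (after time `0`), and the requests
for different contents are independent. -/
structure IsRequestProcess {Ω : Type*} [MeasurableSpace Ω] (P : Measure Ω) {M N : ℕ}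
    (C : Fin N → Set Plane) (lam : Fin M → ℝ≥0) (Q : Fin M → Ω → Set (Plane × ℝ)) : Prop where
  poisson : ∀ i, IsPoissonPointProcess P (Q i)
    (lam i • ((volume.restrict (⋃ j, C j)).prod (volume.restrict (Set.Ioi 0))))
  indep : iIndep (fun i => pointSigma (Q i)) P

/-- The number `H_B` of cache hits in unit time under the placement `B`: the requests, during the
first unit of time, for a content that some base station covering the request has in its cache. -/
def numHits {Ω : Type*} {M N K : ℕ} (C : Fin N → Set Plane) (Q : Fin M → Ω → Set (Plane × ℝ))
    (B : Config M N K) (ω : Ω) : ℕ∞ :=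
  ∑ i, {p ∈ Q i ω | (0 < p.2 ∧ p.2 ≤ 1) ∧ ∃ j, p.1 ∈ C j ∧ B.Has i j}.encard

/-- The cache hit rate `h(B) = E(H_B)`. -/
def hitRate {Ω : Type*} [MeasurableSpace Ω] (P : Measure Ω) {M N K : ℕ} (C : Fin N → Set Plane)
    (Q : Fin M → Ω → Set (Plane × ℝ)) (B : Config M N K) : ℝ :=
  (∫⁻ ω, (numHits C Q B ω : ℝ≥0∞) ∂P).toReal

/-- The set of the placements that maximize `h`. -/
def optimalConfigs {M N K : ℕ} (h : Config M N K → ℝ) : Set (Config M N K) :=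
  {B | ∀ B', h B' ≤ h B}

/-! ### The virtual caches -/

/-- The Gibbs distribution `π_β(B) = exp (β h(B)) / ∑ B', exp (β h(B'))`. -/
def gibbs {M N K : ℕ} (h : Config M N K → ℝ) (β : ℝ) (B : Config M N K) : ℝ :=
  Real.exp (β * h B) / ∑ B', Real.exp (β * h B')

/-- The conditional probability `π_β(A | B_{·,-j})` of the placement `A` under the Gibbs
distribution, given that all caches except that of base station `j` are as in `B`. -/
def gibbsCond {M N K : ℕ} (h : Config M N K → ℝ) (β : ℝ) (j : Fin N) (B A : Config M N K) : ℝ :=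
  if Config.AgreeOff j A B then
    gibbs h β A / ∑ A' with Config.AgreeOff j A' B, gibbs h β A'
  else 0

/-- The probability to go from `B` to `A` in one update: a base station `j` is chosen uniformly,
and the new placement is drawn from `π_β(· | B_{·,-j})`. -/
def gibbsStep {M N K : ℕ} (h : Config M N K → ℝ) (β : ℝ) (B A : Config M N K) : ℝ :=
  ∑ j, (1 / (N : ℝ)) * gibbsCond h β j B A

/-- The inverse temperature at the times `t = l N, l N + 1, …, l N + N - 1` is
`β₀ log (1 + l)`. -/
def invTemp (N : ℕ) (β₀ : ℝ) (t : ℕ) : ℝ := β₀ * Real.log (1 + ((t / N : ℕ) : ℝ))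

/-- The virtual caches `V(0), V(1), …`: starting from an arbitrary `V(0)`, the placement `V(t)`,
`t ≥ 1`, given the past, is drawn by one update of `V(t-1)` at the inverse temperature of time
`t`. -/
structure IsAnnealedGibbsChain {Ω : Type*} [MeasurableSpace Ω] (P : Measure Ω) {M N K : ℕ}
    (h : Config M N K → ℝ) (β₀ : ℝ) (V : ℕ → Ω → Config M N K) : Prop where
  measurable : ∀ t, Measurable (V t)
  transition : ∀ (t : ℕ) (v : ℕ → Config M N K),
    P.real {ω | ∀ s ≤ t + 1, V s ω = v s} =
      P.real {ω | ∀ s ≤ t, V s ω = v s} * gibbsStep h (invTemp N β₀ (t + 1)) (v t) (v (t + 1))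

/-! ### The real caches -/

/-- `S_l = T_1 + ⋯ + T_l`, where the duration `T_k` is written `T (k - 1)`. -/
def epoch (T : ℕ → ℝ) (l : ℕ) : ℝ := ∑ k ∈ Finset.range l, T k

/-- `ζ(τ) = S_{κ(τ)}` with `κ(τ) = sup {l | S_l ≤ τ}`. -/
def lastEpoch (T : ℕ → ℝ) (τ : ℝ) : ℝ := epoch T (sSup {l : ℕ | epoch T l ≤ τ})

/-- `V(u-)`, where `V(τ) = V(t)` for `τ ∈ [t, t+1)`: for `u > 0` the left limit is the value of `V`
at the last integer time before `u`; and `V(0-)` is read as `V(0)`. -/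
def virtualBefore {Ω : Type*} {M N K : ℕ} (V : ℕ → Ω → Config M N K) (u : ℝ) (ω : Ω) :
    Config M N K :=
  V (⌈u⌉₊ - 1) ω

/-- What a request for content `i` from the point `x` may do to the real caches: `r` is the
placement before the request, `r'` the placement after it, and `v` the virtual placement that is
consulted. The request goes to one base station `j` that covers `x`; if some base station covering
`x` has the content, then `j` is one of these. If `j` has content `i`, or if it does not have it and
`v` does not place it at `j`, then nothing changes. Otherwise `j` stores `i` and removes a content
`k ≠ i` which it has in its real cache and which `v` does not place at `j`. -/
def ServeStep {M N K : ℕ} (C : Fin N → Set Plane) (v : Config M N K) (i : Fin M) (x : Plane)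
    (r r' : Config M N K) : Prop :=
  ∃ j, x ∈ C j ∧ ((∃ n, x ∈ C n ∧ r.Has i n) → r.Has i j) ∧
    ((r.Has i j ∨ ¬ v.Has i j) ∧ r' = r ∨
      (¬ r.Has i j ∧ v.Has i j) ∧ ∃ k, k ≠ i ∧ r.Has k j ∧ ¬ v.Has k j ∧
        Config.AgreeOff j r' r ∧ (r' j).1 = insert i ((r j).1.erase k))

/-- The real caches `R(τ)`, `τ ≥ 0`, started from an arbitrary `R(0)`: almost surely they do not
change between requests, and at a request at time `τ` they pass from `R(τ-)` to `R(τ)` according to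
`ServeStep`, where the virtual placement consulted is `V(ζ(τ)-)`. Nothing is required of how the
serving base station and the removed content are chosen among the admissible ones. -/
structure IsRealCacheProcess {Ω : Type*} [MeasurableSpace Ω] (P : Measure Ω) {M N K : ℕ}
    (C : Fin N → Set Plane) (Q : Fin M → Ω → Set (Plane × ℝ)) (V : ℕ → Ω → Config M N K)
    (T : ℕ → ℝ) (R : ℝ → Ω → Config M N K) : Prop where
  measurable : ∀ τ, 0 ≤ τ → Measurable (R τ)
  const : ∀ᵐ ω ∂P, ∀ a b : ℝ, 0 ≤ a → a ≤ b →
    (∀ i, ∀ p ∈ Q i ω, p.2 ∉ Set.Ioc a b) → R b ω = R a ω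
  serve : ∀ᵐ ω ∂P, ∀ i, ∀ p ∈ Q i ω, ∃ r : Config M N K,
    (∀ᶠ a in 𝓝[<] p.2, R a ω = r) ∧
      ServeStep C (virtualBefore V (lastEpoch T p.2) ω) i p.1 r (R p.2 ω)

end

/-! The virtual caches perform simulated annealing with a Gibbs sampler, and the real caches catch
up with them in every epoch.

Virtual caches. During a block of `N` updates the temperature is constant, so the Gibbs law `π_β` of
that block is invariant. Updating the caches one after another leads from any placement to any
other, so all entries of the `N`-step matrix are at least a constant times `exp (-β N Δ)`. For block
`l` this is `c (1 + l) ^ (-γ)` with `γ = β₀ N Δ < 1`. By Dobrushin's argument the distance to `π_β`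
contracts by one minus this amount, and these amounts are not summable. From one block to the next
`π_β` moves by only `O(1 / l)` in `ℓ¹`, which is negligible against the contraction rate, again
because `γ < 1`. So the law of `V` merges with `π_β` (`tendsto_dist_gibbs`), and `π_β` concentrates
on the maximizers of `h` as `β → ∞`.

Real caches. During an epoch the consulted virtual placement `v` is frozen. A content that `v`
assigns to base station `j` is never evicted from `j`, and a request for it from a point covered by
`j` alone puts it there (`ae_has`). Once all contents of positive intensity have been requested from
all such exclusive regions, the real placement contains `v` as far as hits are concerned, and is
optimal if `v` is. The failure probability decays exponentially in the time since the epoch began,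
uniformly over epochs. As the durations tend to infinity, the initial stretch of each epoch does not
count in the time average (`tendsto_average_zero`). -/

/-! ### Contraction of Markov matrices -/

/-- A recursive inequality with a non-summable rate of contraction forces convergence to zero. -/
theorem tendsto_zero_of_le_one_sub_mul_add {d a e : ℕ → ℝ} (hd : ∀ l, 0 ≤ d l)
    (ha : ∀ l, 0 ≤ a l) (hsum : ¬ Summable a) (ha1 : ∀ l, a l ≤ 1)
    (he : Tendsto e atTop (𝓝 0)) (hrec : ∀ l, d (l + 1) ≤ (1 - a l) * d l + a l * e l) :
    Tendsto d atTop (𝓝 0) := by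
  rw [Metric.tendsto_atTop]
  intro ε hε
  obtain ⟨l₀, hl₀⟩ := eventually_atTop.1 (he.eventually_le_const (half_pos hε))
  have key : ∀ k, d (l₀ + k) ≤
      ε / 2 + d l₀ * Real.exp (-∑ i ∈ Finset.range k, a (l₀ + i)) := by
    intro k
    induction k with
    | zero => simp; linarith
    | succ k ih =>
      have h1 := hrec (l₀ + k)
      have h2 := hl₀ (l₀ + k) (Nat.le_add_right _ _)
      have h3 := ha (l₀ + k)
      have h4 : 0 ≤ 1 - a (l₀ + k) := sub_nonneg.2 (ha1 _)
      have h5 : 1 - a (l₀ + k) ≤ Real.exp (-a (l₀ + k)) := Real.one_sub_le_exp_neg _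
      set X := d l₀ * Real.exp (-∑ i ∈ Finset.range k, a (l₀ + i)) with hX
      have hX0 : 0 ≤ X := mul_nonneg (hd _) (Real.exp_pos _).le
      have h6 : d l₀ * Real.exp (-∑ i ∈ Finset.range (k + 1), a (l₀ + i)) =
          X * Real.exp (-a (l₀ + k)) := by
        rw [hX, Finset.sum_range_succ, neg_add, Real.exp_add]; ring
      rw [h6, ← add_assoc]
      calc d (l₀ + k + 1) ≤ (1 - a (l₀ + k)) * (ε / 2 + X) + a (l₀ + k) * (ε / 2) := by
            refine h1.trans (add_le_add (mul_le_mul_of_nonneg_left ih h4)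
              (mul_le_mul_of_nonneg_left h2 h3))
        _ = ε / 2 + X * (1 - a (l₀ + k)) := by ring
        _ ≤ _ := by gcongr
  have hsum' : Tendsto (fun k => ∑ i ∈ Finset.range k, a (l₀ + i)) atTop atTop := by
    rw [← not_summable_iff_tendsto_nat_atTop_of_nonneg (fun i => ha _)]
    simp_rw [add_comm l₀]
    rwa [summable_nat_add_iff]
  have hlim : Tendsto (fun k => d l₀ * Real.exp (-∑ i ∈ Finset.range k, a (l₀ + i))) atTop
      (𝓝 (d l₀ * 0)) :=
    (Real.tendsto_exp_neg_atTop_nhds_zero.comp hsum').const_mul _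
  rw [mul_zero] at hlim
  obtain ⟨k₀, hk₀⟩ := eventually_atTop.1 (hlim.eventually_lt_const (half_pos hε))
  refine ⟨l₀ + k₀, fun n hn => ?_⟩
  obtain ⟨k, rfl⟩ := Nat.exists_eq_add_of_le ((Nat.le_add_right _ _).trans hn)
  have := key k
  have := hk₀ k (by omega)
  rw [Real.dist_eq, sub_zero, abs_of_nonneg (hd _)]
  linarith

section Matrix

variable {ι : Type*} [Fintype ι]

open Matrix

/-- Dobrushin's contraction in total variation, for a matrix whose entries are at least `α`. -/
theorem sum_abs_vecMul_le {Q : Matrix ι ι ℝ} {α : ℝ} (hα : ∀ i j, α ≤ Q i j)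
    (hrow : ∀ i, ∑ j, Q i j = 1) {x : ι → ℝ} (hx : ∑ i, x i = 0) :
    ∑ j, |(x ᵥ* Q) j| ≤ (1 - Fintype.card ι * α) * ∑ i, |x i| := by
  -- Since `x` has total mass zero, subtracting `α` from all entries of `Q` does not change `x ᵥ*
  -- Q`. The entries stay nonnegative and the row sums drop to `1 - card ι * α`.
  have h1 : ∀ j, |(x ᵥ* Q) j| ≤ ∑ i, |x i| * (Q i j - α) := by
    intro j
    have : (x ᵥ* Q) j = ∑ i, x i * (Q i j - α) := by
      simp only [vecMul, dotProduct, mul_sub, Finset.sum_sub_distrib, ← Finset.sum_mul, hx]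
      ring
    rw [this]
    refine (Finset.abs_sum_le_sum_abs _ _).trans_eq (Finset.sum_congr rfl fun i _ => ?_)
    rw [abs_mul, abs_of_nonneg (sub_nonneg.2 (hα i j))]
  refine (Finset.sum_le_sum fun j _ => h1 j).trans_eq ?_
  rw [Finset.sum_comm]
  simp only [← Finset.mul_sum, Finset.sum_sub_distrib, hrow, Finset.sum_const, Finset.card_univ,
    nsmul_eq_mul]
  rw [← Finset.sum_mul, mul_comm]

variable [DecidableEq ι]

theorem row_sum_pow {Q : Matrix ι ι ℝ} (hrow : ∀ i, ∑ j, Q i j = 1) (k : ℕ) (i : ι) :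
    ∑ j, (Q ^ k) i j = 1 := by
  induction k with
  | zero => simp [Matrix.one_apply]
  | succ k ih =>
    simp only [pow_succ, Matrix.mul_apply]
    rw [Finset.sum_comm]
    simp [← Finset.mul_sum, hrow, ih]

theorem pow_entry_nonneg {Q : Matrix ι ι ℝ} (hQ : ∀ i j, 0 ≤ Q i j) (k : ℕ) (i j : ι) :
    0 ≤ (Q ^ k) i j := by
  induction k generalizing j with
  | zero => simp only [pow_zero, Matrix.one_apply]; split_ifs <;> norm_num
  | succ k ih =>
    rw [pow_succ, Matrix.mul_apply]
    exact Finset.sum_nonneg fun l _ => mul_nonneg (ih l) (hQ l j)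

theorem vecMul_pow_of_vecMul {Q : Matrix ι ι ℝ} {p : ι → ℝ} (hp : p ᵥ* Q = p) (k : ℕ) :
    p ᵥ* (Q ^ k) = p := by
  induction k with
  | zero => simp
  | succ k ih => rw [pow_succ, ← vecMul_vecMul, ih, hp]

end Matrix

/-! ### The Gibbs sampler at a fixed temperature -/

section Gibbs

variable {M N K : ℕ}

namespace Config

theorem nonempty_of_le (hK : K ≤ M) : Nonempty (Config M N K) := by
  obtain ⟨c, -, hc⟩ := Finset.exists_subset_card_eq (s := (Finset.univ : Finset (Fin M)))
    (by simpa using hK)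
  exact ⟨fun _ => ⟨c, hc⟩⟩

theorem AgreeOff.refl (j : Fin N) (A : Config M N K) : AgreeOff j A A := fun _ _ => rfl

theorem AgreeOff.symm {j : Fin N} {A B : Config M N K} (h : AgreeOff j A B) : AgreeOff j B A :=
  fun n hn => (h n hn).symm

theorem AgreeOff.trans {j : Fin N} {A B D : Config M N K} (h : AgreeOff j A B)
    (h' : AgreeOff j B D) : AgreeOff j A D :=
  fun n hn => (h n hn).trans (h' n hn)

/-- The placement with the first `k` caches of `A` and the other caches of `B`. -/
def splice (k : ℕ) (A B : Config M N K) : Config M N K := fun n => if n.1 < k then A n else B n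

theorem splice_zero (A B : Config M N K) : splice 0 A B = B := by
  funext n; simp [splice]

theorem splice_self (A B : Config M N K) : splice N A B = A := by
  funext n; simp [splice]

theorem agreeOff_splice_succ (j : Fin N) (A B : Config M N K) :
    AgreeOff j (splice (j.1 + 1) A B) (splice j.1 A B) := by
  intro n hn
  have : n.1 ≠ j.1 := fun h => hn (Fin.ext h)
  simp only [splice]
  have : n.1 < j.1 + 1 ↔ n.1 < j.1 := by omega
  simp [this]

end Config

open Config

theorem le_ciSup_config (h : Config M N K → ℝ) (B : Config M N K) : h B ≤ ⨆ B, h B :=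
  le_ciSup (Set.finite_range h).bddAbove B

theorem ciInf_config_le (h : Config M N K → ℝ) (B : Config M N K) : ⨅ B, h B ≤ h B :=
  ciInf_le (Set.finite_range h).bddBelow B

theorem gibbs_pos (h : Config M N K → ℝ) (β : ℝ) (B : Config M N K) : 0 < gibbs h β B :=
  div_pos (Real.exp_pos _) (Finset.sum_pos (fun _ _ => Real.exp_pos _) ⟨B, Finset.mem_univ _⟩)

theorem sum_gibbs [Nonempty (Config M N K)] (h : Config M N K → ℝ) (β : ℝ) :
    ∑ B, gibbs h β B = 1 := by
  simp only [gibbs]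
  rw [← Finset.sum_div, div_self]
  exact (Finset.sum_pos (fun _ _ => Real.exp_pos _) Finset.univ_nonempty).ne'

theorem sum_agreeOff_pos (h : Config M N K → ℝ) (β : ℝ) (j : Fin N) (B : Config M N K) :
    0 < ∑ A' with AgreeOff j A' B, gibbs h β A' :=
  Finset.sum_pos (fun _ _ => gibbs_pos h β _) ⟨B, by simp [AgreeOff.refl]⟩

theorem gibbsCond_nonneg (h : Config M N K → ℝ) (β : ℝ) (j : Fin N) (B A : Config M N K) :
    0 ≤ gibbsCond h β j B A := by
  unfold gibbsCond
  split_ifs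
  · exact div_nonneg (gibbs_pos h β A).le (sum_agreeOff_pos h β j B).le
  · rfl

theorem sum_gibbsCond (h : Config M N K → ℝ) (β : ℝ) (j : Fin N) (B : Config M N K) :
    ∑ A, gibbsCond h β j B A = 1 := by
  simp only [gibbsCond]
  rw [← Finset.sum_filter, ← Finset.sum_div, div_self (sum_agreeOff_pos h β j B).ne']

/-- Reversibility: agreement off `j` is an equivalence relation, so both conditional laws have the
same normalization. -/
theorem gibbs_mul_gibbsCond_comm (h : Config M N K → ℝ) (β : ℝ) (j : Fin N)
    (B A : Config M N K) :
    gibbs h β B * gibbsCond h β j B A = gibbs h β A * gibbsCond h β j A B := by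
  unfold gibbsCond
  by_cases hAB : AgreeOff j A B
  · rw [if_pos hAB, if_pos hAB.symm]
    have : ∑ A' with AgreeOff j A' B, gibbs h β A' = ∑ A' with AgreeOff j A' A, gibbs h β A' := by
      congr 1
      ext D
      simp only [Finset.mem_filter, Finset.mem_univ, true_and]
      exact ⟨fun hD => hD.trans hAB.symm, fun hD => hD.trans hAB⟩
    rw [this]
    ring
  · rw [if_neg hAB, if_neg fun hBA => hAB hBA.symm, mul_zero, mul_zero]

theorem gibbsStep_nonneg (h : Config M N K → ℝ) (β : ℝ) (B A : Config M N K) :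
    0 ≤ gibbsStep h β B A :=
  Finset.sum_nonneg fun j _ => mul_nonneg (by positivity) (gibbsCond_nonneg h β j B A)

theorem sum_gibbsStep (hN : N ≠ 0) (h : Config M N K → ℝ) (β : ℝ) (B : Config M N K) :
    ∑ A, gibbsStep h β B A = 1 := by
  simp only [gibbsStep]
  rw [Finset.sum_comm]
  simp [← Finset.mul_sum, sum_gibbsCond, hN]

/-- The Gibbs distribution is invariant under the updates. -/
theorem gibbs_vecMul_gibbsStep (hN : N ≠ 0) (h : Config M N K → ℝ) (β : ℝ) :
    Matrix.vecMul (gibbs h β) (Matrix.of (gibbsStep h β)) = gibbs h β := by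
  funext A
  have : ∀ B, gibbs h β B * gibbsStep h β B A = gibbs h β A * gibbsStep h β A B := by
    intro B
    simp only [gibbsStep, Finset.mul_sum]
    refine Finset.sum_congr rfl fun j _ => ?_
    rw [mul_left_comm, gibbs_mul_gibbsCond_comm, mul_left_comm]
  simp only [Matrix.vecMul, dotProduct, Matrix.of_apply, this]
  rw [← Finset.mul_sum, sum_gibbsStep hN, mul_one]

theorem gibbs_ge (h : Config M N K → ℝ) {β : ℝ} (hβ : 0 ≤ β) (A : Config M N K) :
    Real.exp (-(β * ((⨆ B, h B) - ⨅ B, h B))) / Fintype.card (Config M N K) ≤ gibbs h β A := by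
  have hpos : (0 : ℝ) < Fintype.card (Config M N K) := by
    exact_mod_cast Fintype.card_pos_iff.2 ⟨A⟩
  have hZ : ∑ B', Real.exp (β * h B') ≤
      Fintype.card (Config M N K) * Real.exp (β * ⨆ B, h B) := by
    refine (Finset.sum_le_card_nsmul _ _ (Real.exp (β * ⨆ B, h B)) fun B _ => ?_).trans_eq ?_
    · gcongr
      exact le_ciSup_config h B
    · simp
  have hZ0 : 0 < ∑ B', Real.exp (β * h B') :=
    Finset.sum_pos (fun _ _ => Real.exp_pos _) ⟨A, Finset.mem_univ _⟩
  rw [gibbs, div_le_div_iff₀ hpos hZ0]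
  calc _ ≤ Real.exp (-(β * ((⨆ B, h B) - ⨅ B, h B))) *
        (Fintype.card (Config M N K) * Real.exp (β * ⨆ B, h B)) := by gcongr
    _ = Real.exp (β * ⨅ B, h B) * Fintype.card (Config M N K) := by
        rw [mul_left_comm, ← Real.exp_add, mul_comm]
        ring_nf
    _ ≤ _ := by
        gcongr
        exact ciInf_config_le h A

/-- The cache `j` is selected with probability `1 / N`, and conditioning on an event that contains
`A` only increases the Gibbs weight of `A`. -/
theorem gibbsStep_ge_of_agreeOff (h : Config M N K → ℝ) {β : ℝ} (hβ : 0 ≤ β) {j : Fin N}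
    {B A : Config M N K} (hAB : AgreeOff j A B) :
    1 / N * (Real.exp (-(β * ((⨆ B, h B) - ⨅ B, h B))) / Fintype.card (Config M N K)) ≤
      gibbsStep h β B A := by
  have h1 : gibbs h β A ≤ gibbsCond h β j B A := by
    have : Nonempty (Config M N K) := ⟨A⟩
    rw [gibbsCond, if_pos hAB]
    refine le_div_self (gibbs_pos h β A).le (sum_agreeOff_pos h β j B) ?_
    rw [← sum_gibbs h β]
    exact Finset.sum_le_sum_of_subset_of_nonneg (Finset.subset_univ _)
      fun D _ _ => (gibbs_pos h β D).le
  calc _ ≤ 1 / (N : ℝ) * gibbsCond h β j B A := by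
        gcongr
        exact (gibbs_ge h hβ A).trans h1
    _ ≤ _ := Finset.single_le_sum (f := fun j => 1 / (N : ℝ) * gibbsCond h β j B A)
        (fun j _ => mul_nonneg (by positivity) (gibbsCond_nonneg h β j B A)) (Finset.mem_univ j)

/-- Any placement is reached from any other one in `N` updates, one for each cache. -/
theorem gibbsStep_pow_ge [DecidableEq (Config M N K)] (h : Config M N K → ℝ) {β : ℝ}
    (hβ : 0 ≤ β) (B A : Config M N K) :
    (1 / N * (Real.exp (-(β * ((⨆ B, h B) - ⨅ B, h B))) / Fintype.card (Config M N K))) ^ N ≤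
      ((Matrix.of (gibbsStep h β)) ^ N) B A := by
  -- Only one path is kept: the `k`-th update replaces the `k`-th cache of `B` by that of `A`.
  have key : ∀ k ≤ N,
      (1 / N * (Real.exp (-(β * ((⨆ B, h B) - ⨅ B, h B))) / Fintype.card (Config M N K))) ^ k ≤
      ((Matrix.of (gibbsStep h β)) ^ k) B (splice k A B) := by
    intro k
    induction k with
    | zero => simp [splice_zero]
    | succ k ih =>
      intro hk
      have h1 := gibbsStep_ge_of_agreeOff h hβ (agreeOff_splice_succ ⟨k, hk⟩ A B)
      rw [pow_succ, pow_succ, Matrix.mul_apply]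
      refine (mul_le_mul (ih (by omega)) h1 (by positivity)
        (pow_entry_nonneg (gibbsStep_nonneg h β) k _ _)).trans ?_
      exact Finset.single_le_sum
        (f := fun D => ((Matrix.of (gibbsStep h β)) ^ k) B D *
          Matrix.of (gibbsStep h β) D (splice (k + 1) A B))
        (fun D _ => mul_nonneg (pow_entry_nonneg (gibbsStep_nonneg h β) k _ _)
          (gibbsStep_nonneg h β _ _)) (Finset.mem_univ _)
  simpa [splice_self] using key N le_rfl

/-- The factor `exp ((β' - β) * h)` lies between its values at the minimum and the maximum of `h`,
for the numerator as well as for the partition function. The quotient of these two values is the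
constant. -/
theorem gibbs_le_exp_mul_gibbs (h : Config M N K → ℝ) {β β' : ℝ} (hβ : β ≤ β')
    (B : Config M N K) :
    gibbs h β' B ≤ Real.exp ((β' - β) * ((⨆ B, h B) - ⨅ B, h B)) * gibbs h β B ∧
      gibbs h β B ≤ Real.exp ((β' - β) * ((⨆ B, h B) - ⨅ B, h B)) * gibbs h β' B := by
  set s := ⨆ B, h B
  set m := ⨅ B, h B
  have hδ : 0 ≤ β' - β := sub_nonneg.2 hβ
  have hZ : 0 < ∑ B', Real.exp (β * h B') :=
    Finset.sum_pos (fun _ _ => Real.exp_pos _) ⟨B, Finset.mem_univ _⟩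
  have hZ' : 0 < ∑ B', Real.exp (β' * h B') :=
    Finset.sum_pos (fun _ _ => Real.exp_pos _) ⟨B, Finset.mem_univ _⟩
  have up : ∀ D, Real.exp (β' * h D) ≤ Real.exp ((β' - β) * s) * Real.exp (β * h D) := by
    intro D
    rw [← Real.exp_add]
    gcongr
    have := mul_le_mul_of_nonneg_left (le_ciSup_config h D) hδ
    linarith
  have lo : ∀ D, Real.exp ((β' - β) * m) * Real.exp (β * h D) ≤ Real.exp (β' * h D) := by
    intro D
    rw [← Real.exp_add]
    gcongr
    have := mul_le_mul_of_nonneg_left (ciInf_config_le h D) hδ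
    linarith
  have upZ : ∑ D, Real.exp (β' * h D) ≤ Real.exp ((β' - β) * s) * ∑ D, Real.exp (β * h D) := by
    rw [Finset.mul_sum]
    exact Finset.sum_le_sum fun D _ => up D
  have loZ : Real.exp ((β' - β) * m) * ∑ D, Real.exp (β * h D) ≤ ∑ D, Real.exp (β' * h D) := by
    rw [Finset.mul_sum]
    exact Finset.sum_le_sum fun D _ => lo D
  have hsm : Real.exp ((β' - β) * (s - m)) =
      Real.exp ((β' - β) * s) / Real.exp ((β' - β) * m) := by
    rw [← Real.exp_sub]; ring_nf
  have hem := Real.exp_pos ((β' - β) * m)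
  have hes := Real.exp_pos ((β' - β) * s)
  rw [hsm, gibbs, gibbs, div_mul_div_comm, div_mul_div_comm]
  constructor
  · rw [div_le_div_iff₀ hZ' (by positivity)]
    exact mul_le_mul (up B) loZ (by positivity) (by positivity)
  · rw [div_le_div_iff₀ hZ (by positivity)]
    calc _ = (Real.exp ((β' - β) * m) * Real.exp (β * h B)) * ∑ D, Real.exp (β' * h D) := by ring
      _ ≤ Real.exp (β' * h B) * (Real.exp ((β' - β) * s) * ∑ D, Real.exp (β * h D)) :=
        mul_le_mul (lo B) upZ hZ'.le (by positivity)
      _ = _ := by ring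

theorem sum_abs_gibbs_sub_gibbs_le (h : Config M N K → ℝ) [Nonempty (Config M N K)] {β β' : ℝ}
    (hβ : β ≤ β') :
    ∑ B, |gibbs h β B - gibbs h β' B| ≤
      Real.exp ((β' - β) * ((⨆ B, h B) - ⨅ B, h B)) - 1 := by
  set E := Real.exp ((β' - β) * ((⨆ B, h B) - ⨅ B, h B)) with hE
  have hE1 : 1 ≤ E := by
    refine Real.one_le_exp (mul_nonneg (sub_nonneg.2 hβ) (sub_nonneg.2 ?_))
    exact (ciInf_config_le h (Classical.arbitrary _)).trans (le_ciSup_config h _)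
  have : ∀ B, |gibbs h β B - gibbs h β' B| ≤ (E - 1) * gibbs h β B := by
    intro B
    obtain ⟨h1, h2⟩ := gibbs_le_exp_mul_gibbs h hβ B
    rw [← hE] at h1 h2
    rw [abs_le]
    refine ⟨by linarith, ?_⟩
    have h3 : gibbs h β B - gibbs h β' B ≤ (E - 1) * gibbs h β' B := by linarith
    rcases le_total (gibbs h β B) (gibbs h β' B) with h4 | h4
    · have := mul_nonneg (sub_nonneg.2 hE1) (gibbs_pos h β B).le
      linarith
    · exact h3.trans (mul_le_mul_of_nonneg_left h4 (sub_nonneg.2 hE1))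
  refine (Finset.sum_le_sum fun B _ => this B).trans_eq ?_
  rw [← Finset.mul_sum, sum_gibbs, mul_one]

/-- A strictly better placement `A` outweighs `B` by the factor `exp (β * (h A - h B))`. -/
theorem tendsto_gibbs_zero_of_notMem_optimalConfigs (h : Config M N K → ℝ) {B : Config M N K}
    (hB : B ∉ optimalConfigs h) : Tendsto (fun β => gibbs h β B) atTop (𝓝 0) := by
  simp only [optimalConfigs, Set.mem_ofPred_eq, not_forall, not_le] at hB
  obtain ⟨A, hA⟩ := hB
  have h1 : ∀ β, gibbs h β B ≤ Real.exp (-(β * (h A - h B))) := by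
    intro β
    rw [gibbs, div_le_iff₀ (Finset.sum_pos (fun _ _ => Real.exp_pos _) ⟨B, Finset.mem_univ _⟩)]
    calc Real.exp (β * h B) = Real.exp (-(β * (h A - h B))) * Real.exp (β * h A) := by
          rw [← Real.exp_add]; ring_nf
      _ ≤ _ := by
          gcongr
          exact Finset.single_le_sum (f := fun B' => Real.exp (β * h B'))
            (fun _ _ => (Real.exp_pos _).le) (Finset.mem_univ A)
  refine squeeze_zero (fun β => (gibbs_pos h β B).le) h1 ?_
  exact Real.tendsto_exp_neg_atTop_nhds_zero.comp
    (tendsto_id.atTop_mul_const (sub_pos.2 hA))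

end Gibbs

/-! ### The annealed Gibbs chain -/

section Annealing

open Config Matrix

variable {Ω : Type*} [MeasurableSpace Ω] {P : Measure Ω} {M N K : ℕ} {h : Config M N K → ℝ}
  {β₀ : ℝ} {V : ℕ → Ω → Config M N K}

instance : DiscreteMeasurableSpace (Config M N K) := ⟨fun _ => trivial⟩

/-- The sum over the values of a random placement of the probabilities of an event. -/
theorem sum_measureReal_inter_eq [IsFiniteMeasure P] {X : Ω → Config M N K} (hX : Measurable X)
    (E : Set Ω) : ∑ B, P.real (E ∩ {ω | X ω = B}) = P.real E := by
  have hm : ∀ B, MeasurableSet (X ⁻¹' {B}) := fun B => hX .of_discrete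
  have := sum_measureReal_preimage_singleton (μ := P.restrict E) Finset.univ fun B _ => hm B
  rw [Finset.coe_univ, Set.preimage_univ, measureReal_restrict_apply_univ] at this
  rw [← this]
  refine Finset.sum_congr rfl fun B _ => ?_
  rw [measureReal_restrict_apply (hm B), Set.inter_comm]
  rfl

/-- The transition rule prescribes the whole past. Summing over the value at the earliest time
forgets the past one step at a time, which leaves the Markov property for a window that starts at
`s`. -/
theorem IsAnnealedGibbsChain.measureReal_path [IsFiniteMeasure P]
    (hV : IsAnnealedGibbsChain P h β₀ V) (t s : ℕ) (hs : s ≤ t) (v : ℕ → Config M N K) :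
    P.real {ω | ∀ r, s ≤ r → r ≤ t + 1 → V r ω = v r} =
      P.real {ω | ∀ r, s ≤ r → r ≤ t → V r ω = v r} *
        gibbsStep h (invTemp N β₀ (t + 1)) (v t) (v (t + 1)) := by
  induction s generalizing v with
  | zero => simpa using hV.transition t v
  | succ s ih =>
    have split : ∀ u, s + 1 ≤ u → P.real {ω | ∀ r, s + 1 ≤ r → r ≤ u → V r ω = v r} =
        ∑ B, P.real {ω | ∀ r, s ≤ r → r ≤ u → V r ω = Function.update v s B r} := by
      intro u hu
      rw [← sum_measureReal_inter_eq (hV.measurable s)]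
      refine Finset.sum_congr rfl fun B _ => ?_
      congr 1
      ext ω
      simp only [Set.mem_inter_iff, Set.mem_ofPred_eq]
      constructor
      · rintro ⟨h1, h2⟩ r hr hru
        rcases hr.eq_or_lt with rfl | hr
        · simpa using h2
        · rw [Function.update_of_ne (by omega)]
          exact h1 r hr hru
      · intro h1
        refine ⟨fun r hr hru => ?_, ?_⟩
        · have := h1 r (by omega) hru
          rwa [Function.update_of_ne (by omega)] at this
        · simpa using h1 s le_rfl (by omega)
    rw [split (t + 1) (by omega), split t hs, Finset.sum_mul]
    refine Finset.sum_congr rfl fun B _ => ?_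
    rw [ih (by omega), Function.update_of_ne (by omega), Function.update_of_ne (by omega)]

/-- The one-dimensional laws of the chain evolve by the transition matrices. -/
theorem IsAnnealedGibbsChain.law_succ [IsFiniteMeasure P] (hV : IsAnnealedGibbsChain P h β₀ V)
    (t : ℕ) :
    (fun A => P.real {ω | V (t + 1) ω = A}) =
      (fun B => P.real {ω | V t ω = B}) ᵥ* Matrix.of (gibbsStep h (invTemp N β₀ (t + 1))) := by
  funext A
  rw [← sum_measureReal_inter_eq (hV.measurable t)]
  simp only [vecMul, dotProduct, Matrix.of_apply]
  refine Finset.sum_congr rfl fun B _ => ?_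
  have := hV.measureReal_path t t le_rfl (fun r => if r = t then B else A)
  simp only [if_true, Nat.succ_ne_self, if_false] at this
  convert this using 2
  · ext ω
    simp only [Set.mem_inter_iff, Set.mem_ofPred_eq]
    constructor
    · rintro ⟨h1, h2⟩ r hr hr'
      obtain rfl | rfl : r = t ∨ r = t + 1 := by omega
      · simpa using h2
      · simpa using h1
    · intro h1
      exact ⟨by simpa using h1 (t + 1) (by omega) le_rfl, by simpa using h1 t le_rfl (by omega)⟩
  · congr 1
    ext ω
    simp only [Set.mem_ofPred_eq]
    constructor
    · intro h1 r hr hr'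
      obtain rfl : r = t := le_antisymm hr' hr
      simpa using h1
    · intro h1
      simpa using h1 t le_rfl le_rfl

theorem invTemp_of_block (hN : N ≠ 0) (β₀ : ℝ) (l k : ℕ) (hk : k < N) :
    invTemp N β₀ (l * N + k) = β₀ * Real.log (1 + l) := by
  have : (l * N + k) / N = l := by
    rw [add_comm, Nat.add_mul_div_right _ _ (Nat.pos_of_ne_zero hN), Nat.div_eq_of_lt hk, zero_add]
  rw [invTemp, this]

/-- Within a block of `N` updates the chain is homogeneous. -/
theorem IsAnnealedGibbsChain.law_block [IsFiniteMeasure P] [DecidableEq (Config M N K)]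
    (hN : N ≠ 0) (hV : IsAnnealedGibbsChain P h β₀ V) (l k : ℕ) (hk : k ≤ N) :
    (fun A => P.real {ω | V ((l + 1) * N - 1 + k) ω = A}) =
      (fun B => P.real {ω | V ((l + 1) * N - 1) ω = B}) ᵥ*
        (Matrix.of (gibbsStep h (β₀ * Real.log (1 + (l + 1 : ℕ))))) ^ k := by
  induction k with
  | zero => simp
  | succ k ih =>
    have h1 : (l + 1) * N - 1 + k + 1 = (l + 1) * N + k := by
      have : 0 < (l + 1) * N := Nat.mul_pos (by omega) (Nat.pos_of_ne_zero hN)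
      omega
    rw [← add_assoc, hV.law_succ, ih (by omega), h1, invTemp_of_block hN _ _ _ (by omega), pow_succ,
      vecMul_vecMul]

theorem sum_measureReal_eq_one [IsProbabilityMeasure P] {X : Ω → Config M N K}
    (hX : Measurable X) : ∑ B, P.real {ω | X ω = B} = 1 := by
  simpa using sum_measureReal_inter_eq hX (P := P) Set.univ

/-- With the logarithmic schedule and `β₀ Δ ≤ 1`, the factor `exp ((β' - β) * Δ)` is at most `(2 +
l) / (1 + l)`. -/
theorem sum_abs_gibbs_log_sub_le [Nonempty (Config M N K)] (hβ₀ : 0 < β₀)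
    (hgap : β₀ * ((⨆ B, h B) - ⨅ B, h B) ≤ 1) (l : ℕ) :
    ∑ B, |gibbs h (β₀ * Real.log (1 + l)) B - gibbs h (β₀ * Real.log (1 + (l + 1 : ℕ))) B| ≤
      1 / (1 + l) := by
  have hl : (0 : ℝ) < 1 + l := by positivity
  have hlog : Real.log (1 + l) ≤ Real.log (1 + (l + 1 : ℕ)) :=
    Real.log_le_log hl (by push_cast; linarith)
  refine (sum_abs_gibbs_sub_gibbs_le h (by gcongr)).trans ?_
  have h1 : (β₀ * Real.log (1 + (l + 1 : ℕ)) - β₀ * Real.log (1 + l)) *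
      ((⨆ B, h B) - ⨅ B, h B) ≤ Real.log ((1 + (l + 1 : ℕ)) / (1 + l)) := by
    rw [Real.log_div (by positivity) hl.ne']
    calc _ = (Real.log (1 + (l + 1 : ℕ)) - Real.log (1 + l)) *
          (β₀ * ((⨆ B, h B) - ⨅ B, h B)) := by ring
      _ ≤ (Real.log (1 + (l + 1 : ℕ)) - Real.log (1 + l)) * 1 :=
          mul_le_mul_of_nonneg_left hgap (sub_nonneg.2 hlog)
      _ = _ := mul_one _
  have h2 := Real.exp_le_exp.2 h1
  rw [Real.exp_log (by positivity)] at h2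
  have h3 : ((1 : ℝ) + (l + 1 : ℕ)) / (1 + l) = 1 + 1 / (1 + l) := by
    push_cast
    field_simp
    ring
  linarith

/-- At the ends of the blocks the law of the chain approaches the Gibbs distribution. -/
theorem IsAnnealedGibbsChain.tendsto_dist_gibbs [IsProbabilityMeasure P] (hK : K ≤ M)
    (hN : N ≠ 0) (hβ₀ : 0 < β₀) (hgap : β₀ * N * ((⨆ B, h B) - ⨅ B, h B) < 1)
    (hV : IsAnnealedGibbsChain P h β₀ V) :
    Tendsto (fun l : ℕ => ∑ A, |P.real {ω | V ((l + 1) * N - 1) ω = A} -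
      gibbs h (β₀ * Real.log (1 + (l + 1 : ℕ))) A|) atTop (𝓝 0) := by
  classical
  have : Nonempty (Config M N K) := nonempty_of_le hK
  set Δ := (⨆ B, h B) - ⨅ B, h B with hΔ
  have hΔ0 : 0 ≤ Δ :=
    sub_nonneg.2 ((ciInf_config_le h (Classical.arbitrary _)).trans (le_ciSup_config h _))
  have hN1 : (1 : ℝ) ≤ N := by exact_mod_cast Nat.one_le_iff_ne_zero.2 hN
  set n := Fintype.card (Config M N K) with hn
  have hn1 : (1 : ℝ) ≤ n := by exact_mod_cast Fintype.card_pos (α := Config M N K)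
  set c : ℝ := (1 / N * (1 / n)) ^ N with hc
  have hc0 : 0 < c := by positivity
  have hc1 : c ≤ 1 := by
    refine pow_le_one₀ (by positivity) (mul_le_one₀ ?_ (by positivity) ?_)
    · exact (div_le_one (by positivity)).2 hN1
    · exact (div_le_one (by positivity)).2 hn1
  set γ := β₀ * N * Δ with hγ
  have hγ0 : 0 ≤ γ := by positivity
  set a : ℕ → ℝ := fun l => c * (1 + (l + 1 : ℕ) : ℝ) ^ (-γ) with ha
  have hbase : ∀ l : ℕ, (1 : ℝ) ≤ 1 + (l + 1 : ℕ) := fun l => by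
    have : (0 : ℝ) ≤ (l + 1 : ℕ) := by positivity
    linarith
  have hgap' : β₀ * Δ ≤ 1 := by
    refine le_trans ?_ hgap.le
    rw [hγ, mul_right_comm]
    exact le_mul_of_one_le_right (by positivity) hN1
  have hentry : ∀ (l : ℕ) (B A : Config M N K), a l ≤
      ((Matrix.of (gibbsStep h (β₀ * Real.log (1 + (l + 1 : ℕ))))) ^ N) B A := by
    intro l B A
    have hβ : 0 ≤ β₀ * Real.log (1 + (l + 1 : ℕ)) :=
      mul_nonneg hβ₀.le (Real.log_nonneg (hbase l))
    refine le_trans (le_of_eq ?_) (gibbsStep_pow_ge h hβ B A)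
    have : Real.exp (-(β₀ * Real.log (1 + (l + 1 : ℕ)) * Δ)) ^ N =
        (1 + (l + 1 : ℕ) : ℝ) ^ (-γ) := by
      rw [← Real.exp_nat_mul, Real.rpow_def_of_pos (by linarith [hbase l])]
      congr 1
      rw [hγ]; ring
    rw [ha, hc]
    simp only
    rw [← this, ← mul_pow]
    congr 1
    ring
  -- `e` is the drift `1 / (l + 2)` of the Gibbs law divided by the rate `a l`. Non-summability of
  -- `a` and `e → 0` both come from `γ < 1`.
  refine tendsto_zero_of_le_one_sub_mul_add (a := a)
    (e := fun l => 1 / c * (1 + (l + 1 : ℕ) : ℝ) ^ (-(1 - γ))) (fun l => by positivity)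
    (fun l => by positivity) ?_ ?_ ?_ ?_
  · intro hsum
    have h1 : Summable fun l : ℕ => ((l + 2 : ℕ) : ℝ)⁻¹ := by
      refine Summable.of_nonneg_of_le (fun l => by positivity) (fun l => ?_)
        (hsum.mul_left (1 / c))
      have h2 : 1 / c * a l = (1 + (l + 1 : ℕ) : ℝ) ^ (-γ) := by
        rw [ha]; field_simp
      rw [h2, ← Real.rpow_neg_one]
      have h3 : ((l + 2 : ℕ) : ℝ) = 1 + (l + 1 : ℕ) := by push_cast; ring
      rw [h3]
      exact Real.rpow_le_rpow_of_exponent_le (hbase l) (by linarith)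
    rw [summable_nat_add_iff (f := fun l : ℕ => (l : ℝ)⁻¹) 2] at h1
    exact Real.not_summable_natCast_inv h1
  · intro l
    refine mul_le_one₀ hc1 (by positivity) ?_
    exact Real.rpow_le_one_of_one_le_of_nonpos (hbase l) (by linarith)
  · rw [← mul_zero (1 / c)]
    refine Tendsto.const_mul _ ((tendsto_rpow_neg_atTop (sub_pos.2 hgap)).comp ?_)
    exact tendsto_atTop_add_const_left _ _
      (tendsto_natCast_atTop_atTop.comp (tendsto_add_atTop_nat 1))
  · intro l
    set β := β₀ * Real.log (1 + (l + 1 : ℕ)) with hβ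
    set β' := β₀ * Real.log (1 + (l + 1 + 1 : ℕ)) with hβ'
    set Q := (Matrix.of (gibbsStep h β)) ^ N with hQ
    have hrow : ∀ i, ∑ j, Q i j = 1 := row_sum_pow (sum_gibbsStep hN h β) N
    -- Time `(l + 1) * N - 1` is the last of block `l`. The next `N` updates form block `l + 1`, so
    -- the law is compared with the Gibbs law of the coming block.
    have hlaw : (fun A => P.real {ω | V ((l + 1 + 1) * N - 1) ω = A}) =
        (fun B => P.real {ω | V ((l + 1) * N - 1) ω = B}) ᵥ* Q := by
      rw [hQ, ← hV.law_block hN l N le_rfl]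
      have : (l + 1 + 1) * N - 1 = (l + 1) * N - 1 + N := by
        have h1 : 0 < (l + 1) * N := Nat.mul_pos (by omega) (Nat.pos_of_ne_zero hN)
        have h2 : (l + 1 + 1) * N = (l + 1) * N + N := by ring
        omega
      rw [this]
    have hinv : gibbs h β ᵥ* Q = gibbs h β :=
      vecMul_pow_of_vecMul (gibbs_vecMul_gibbsStep hN h β) N
    have hcontr := sum_abs_vecMul_le (hentry l) hrow
      (x := (fun B => P.real {ω | V ((l + 1) * N - 1) ω = B}) - gibbs h β) (by
        simp only [Pi.sub_apply, Finset.sum_sub_distrib, sum_gibbs]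
        rw [sum_measureReal_eq_one (hV.measurable _), sub_self])
    rw [sub_vecMul, hinv, ← hlaw] at hcontr
    simp only [Pi.sub_apply] at hcontr
    have hdiff := sum_abs_gibbs_log_sub_le (h := h) hβ₀ hgap' (l + 1)
    rw [← hβ, ← hβ'] at hdiff
    have htri : ∑ A, |P.real {ω | V ((l + 1 + 1) * N - 1) ω = A} - gibbs h β' A| ≤
        ∑ A, |P.real {ω | V ((l + 1 + 1) * N - 1) ω = A} - gibbs h β A| +
          ∑ A, |gibbs h β A - gibbs h β' A| := by
      rw [← Finset.sum_add_distrib]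
      exact Finset.sum_le_sum fun A _ => abs_sub_le _ _ _
    have hae : a l * (1 / c * (1 + (l + 1 : ℕ) : ℝ) ^ (-(1 - γ))) = 1 / (1 + (l + 1 : ℕ)) := by
      rw [ha]
      simp only
      rw [show c * (1 + (l + 1 : ℕ) : ℝ) ^ (-γ) * (1 / c * (1 + (l + 1 : ℕ) : ℝ) ^ (-(1 - γ))) =
        (1 + (l + 1 : ℕ) : ℝ) ^ (-γ) * (1 + (l + 1 : ℕ) : ℝ) ^ (-(1 - γ)) by field_simp,
        ← Real.rpow_add (by linarith [hbase l])]
      rw [show -γ + -(1 - γ) = -1 by ring, Real.rpow_neg_one, one_div]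
    rw [hae]
    have hweak : (1 - n * a l) * ∑ A, |P.real {ω | V ((l + 1) * N - 1) ω = A} - gibbs h β A| ≤
        (1 - a l) * ∑ A, |P.real {ω | V ((l + 1) * N - 1) ω = A} - gibbs h β A| := by
      refine mul_le_mul_of_nonneg_right ?_ (by positivity)
      have : a l ≤ n * a l := le_mul_of_one_le_left (by positivity) hn1
      linarith
    linarith

/-- The annealed chain concentrates on the optimal placements. -/
theorem IsAnnealedGibbsChain.tendsto_measureReal_notMem_optimalConfigs [IsProbabilityMeasure P]
    (hK : K ≤ M) (hN : N ≠ 0) (hβ₀ : 0 < β₀)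
    (hgap : β₀ * N * ((⨆ B, h B) - ⨅ B, h B) < 1) (hV : IsAnnealedGibbsChain P h β₀ V) :
    Tendsto (fun t => P.real {ω | V t ω ∉ optimalConfigs h}) atTop (𝓝 0) := by
  classical
  have hNpos : 0 < N := Nat.pos_of_ne_zero hN
  set f : ℕ → ℝ := fun l => ∑ A, |P.real {ω | V ((l + 1) * N - 1) ω = A} -
    gibbs h (β₀ * Real.log (1 + (l + 1 : ℕ))) A| with hf
  set g : ℕ → ℝ := fun l => ∑ B with B ∉ optimalConfigs h,
    gibbs h (β₀ * Real.log (1 + (l + 1 : ℕ))) B with hg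
  have hfl : Tendsto f atTop (𝓝 0) := hV.tendsto_dist_gibbs hK hN hβ₀ hgap
  have hgl : Tendsto g atTop (𝓝 0) := by
    rw [← Finset.sum_const_zero (s := Finset.univ.filter fun B => B ∉ optimalConfigs h)]
    refine tendsto_finsetSum _ fun B hB => ?_
    refine (tendsto_gibbs_zero_of_notMem_optimalConfigs h (Finset.mem_filter.1 hB).2).comp ?_
    refine Tendsto.const_mul_atTop hβ₀ (Real.tendsto_log_atTop.comp ?_)
    exact tendsto_atTop_add_const_left _ _
      (tendsto_natCast_atTop_atTop.comp (tendsto_add_atTop_nat 1))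
  have hbound : ∀ l k, k ≤ N →
      P.real {ω | V ((l + 1) * N - 1 + k) ω ∉ optimalConfigs h} ≤ f l + g l := by
    intro l k hk
    set t := (l + 1) * N - 1 + k with ht
    set β := β₀ * Real.log (1 + (l + 1 : ℕ)) with hβ
    set Q := (Matrix.of (gibbsStep h β)) ^ k with hQ
    have h1 : P.real {ω | V t ω ∉ optimalConfigs h} ≤
        ∑ B with B ∉ optimalConfigs h, P.real {ω | V t ω = B} := by
      refine le_trans (measureReal_mono ?_ (measure_ne_top _ _))
        (measureReal_biUnion_finset_le (Finset.univ.filter fun B => B ∉ optimalConfigs h)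
          fun B => {ω | V t ω = B})
      intro ω hω
      simpa using hω
    have h2 : ∑ B with B ∉ optimalConfigs h, P.real {ω | V t ω = B} ≤
        ∑ B, |P.real {ω | V t ω = B} - gibbs h β B| + g l := by
      have h3 : ∀ B, P.real {ω | V t ω = B} ≤
          |P.real {ω | V t ω = B} - gibbs h β B| + gibbs h β B := fun B => by
        linarith [le_abs_self (P.real {ω | V t ω = B} - gibbs h β B)]
      refine (Finset.sum_le_sum fun B _ => h3 B).trans ?_
      rw [Finset.sum_add_distrib]
      refine add_le_add ?_ le_rfl
      exact Finset.sum_le_sum_of_subset_of_nonneg (Finset.subset_univ _)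
        fun _ _ _ => abs_nonneg _
    -- Inside a block it is enough that the distance does not grow.
    have hcontr := sum_abs_vecMul_le (Q := Q) (α := 0)
      (pow_entry_nonneg (gibbsStep_nonneg h β) k) (row_sum_pow (sum_gibbsStep hN h β) k)
      (x := (fun B => P.real {ω | V ((l + 1) * N - 1) ω = B}) - gibbs h β) (by
        have : Nonempty (Config M N K) := nonempty_of_le hK
        simp only [Pi.sub_apply, Finset.sum_sub_distrib, sum_gibbs]
        rw [sum_measureReal_eq_one (hV.measurable _), sub_self])
    rw [sub_vecMul, hQ, vecMul_pow_of_vecMul (gibbs_vecMul_gibbsStep hN h β) k,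
      ← hV.law_block hN l k hk, mul_zero, sub_zero, one_mul] at hcontr
    simp only [Pi.sub_apply] at hcontr
    exact h1.trans (h2.trans (add_le_add hcontr le_rfl))
  have hidx : Tendsto (fun t : ℕ => (t + 1) / N - 1) atTop atTop :=
    (tendsto_sub_atTop_nat 1).comp
      ((Nat.tendsto_div_const_atTop hN).comp (tendsto_add_atTop_nat 1))
  have hlim : Tendsto (fun t : ℕ => f ((t + 1) / N - 1) + g ((t + 1) / N - 1)) atTop (𝓝 0) := by
    simpa using (hfl.comp hidx).add (hgl.comp hidx)
  refine squeeze_zero' (.of_forall fun t => measureReal_nonneg) ?_ hlim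
  filter_upwards [eventually_ge_atTop N] with t ht
  have h1 : 1 ≤ (t + 1) / N := (Nat.one_le_div_iff hNpos).2 (by omega)
  -- Division of `t + 1` by `N` writes `t` as the end of a block plus a remainder.
  have h2 : ((t + 1) / N - 1 + 1) * N - 1 + (t + 1) % N = t := by
    rw [Nat.sub_add_cancel h1]
    have h3 := Nat.div_add_mod (t + 1) N
    have h4 : 0 < (t + 1) / N * N := Nat.mul_pos h1 hNpos
    rw [mul_comm] at h3
    omega
  have := hbound ((t + 1) / N - 1) ((t + 1) % N) (Nat.mod_lt _ hNpos).le
  rwa [h2] at this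

end Annealing

/-! ### Poisson point processes -/

section Poisson

variable {Ω α : Type*} [MeasurableSpace Ω] [MeasurableSpace α] {P : Measure Ω} {X : Ω → Set α}
  {ν : Measure α} {A : Set α}

namespace IsPoissonPointProcess

theorem measurableSet_inter_eq_empty (hX : IsPoissonPointProcess P X ν) (hA : MeasurableSet A) :
    MeasurableSet {ω | X ω ∩ A = ∅} := by
  have : {ω | X ω ∩ A = ∅} = (fun ω => (X ω ∩ A).encard) ⁻¹' {0} := by
    ext ω; simp
  rw [this]
  exact hX.measurable_count A hA (MeasurableSet.of_discrete)

theorem measureReal_inter_eq_empty (hX : IsPoissonPointProcess P X ν) (hA : MeasurableSet A)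
    (hν : ν A ≠ ∞) : P.real {ω | X ω ∩ A = ∅} = Real.exp (-ν.real A) := by
  have h1 := hX.law_count A hA hν 0
  simp only [Nat.cast_zero, Set.encard_eq_zero] at h1
  rw [measureReal_def, h1, ← measureReal_def, poissonMeasure_real_singleton]
  simp [measureReal_def, ENNReal.coe_toNNReal_eq_toReal]

theorem measureReal_inter_ne_empty_le [IsProbabilityMeasure P] (hX : IsPoissonPointProcess P X ν)
    (hA : MeasurableSet A) (hν : ν A ≠ ∞) : P.real {ω | X ω ∩ A ≠ ∅} ≤ ν.real A := by
  have h1 := probReal_compl_eq_one_sub (μ := P) (hX.measurableSet_inter_eq_empty hA)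
  rw [hX.measureReal_inter_eq_empty hA hν] at h1
  have h2 : {ω | X ω ∩ A ≠ ∅} = {ω | X ω ∩ A = ∅}ᶜ := rfl
  rw [h2, h1]
  linarith [Real.one_sub_le_exp_neg (ν.real A)]

theorem ae_inter_eq_empty [IsProbabilityMeasure P] (hX : IsPoissonPointProcess P X ν)
    (hA : MeasurableSet A) (hν : ν A = 0) : ∀ᵐ ω ∂P, X ω ∩ A = ∅ := by
  have h1 := hX.measureReal_inter_ne_empty_le hA (by simp [hν])
  rw [measureReal_def, measureReal_def, hν, ENNReal.toReal_zero] at h1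
  have h2 := (ENNReal.toReal_eq_zero_iff _).1 (h1.antisymm ENNReal.toReal_nonneg)
  exact h2.resolve_right (measure_ne_top _ _)

/-- The Poisson weights of the finite counts already add up to one, so an infinite count has
probability zero. -/
theorem ae_finite_inter [IsProbabilityMeasure P] (hX : IsPoissonPointProcess P X ν)
    (hA : MeasurableSet A) (hν : ν A ≠ ∞) : ∀ᵐ ω ∂P, (X ω ∩ A).Finite := by
  have hm : ∀ n : ℕ, MeasurableSet {ω | (X ω ∩ A).encard = n} := fun n =>
    hX.measurable_count A hA (MeasurableSet.of_discrete (s := {(n : ℕ∞)}))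
  have h1 : P (⋃ n : ℕ, {ω | (X ω ∩ A).encard = n}) = 1 := by
    rw [measure_iUnion _ hm]
    · simp_rw [hX.law_count A hA hν]
      rw [← measure_iUnion (fun m n hmn => Set.disjoint_singleton.2 hmn)
        fun n => MeasurableSet.singleton n, Set.iUnion_of_singleton, measure_univ]
    · intro m n hmn
      refine Set.disjoint_left.2 fun ω h1 h2 => hmn ?_
      exact_mod_cast (h1 : (X ω ∩ A).encard = m).symm.trans h2
  have h2 : ∀ᵐ ω ∂P, ω ∈ ⋃ n : ℕ, {ω | (X ω ∩ A).encard = n} :=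
    (prob_compl_eq_zero_iff (MeasurableSet.iUnion hm)).2 h1
  filter_upwards [h2] with ω hω
  obtain ⟨n, hn⟩ := Set.mem_iUnion.1 hω
  exact Set.finite_of_encard_eq_coe hn

/-- `hitRate` is defined through `toReal`, which sends `∞` to `0`; finite means are what makes it
monotone in the number of hits. -/
theorem lintegral_count_ne_top [IsProbabilityMeasure P] (hX : IsPoissonPointProcess P X ν)
    (hA : MeasurableSet A) (hν : ν A ≠ ∞) :
    ∫⁻ ω, ((X ω ∩ A).encard : ℝ≥0∞) ∂P ≠ ∞ := by
  set r := (ν A).toNNReal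
  have hfin := hX.ae_finite_inter hA hν
  set g : Ω → ℕ := fun ω => (X ω ∩ A).encard.toNat with hg
  have hgm : Measurable g := (measurable_of_countable ENat.toNat).comp (hX.measurable_count A hA)
  have hmap : P.map g = poissonMeasure r := by
    refine Measure.ext_of_singleton fun n => ?_
    rw [Measure.map_apply hgm (MeasurableSet.singleton n), ← hX.law_count A hA hν n]
    refine measure_congr ?_
    filter_upwards [hfin] with ω hω
    refine propext ?_
    change (X ω ∩ A).encard.toNat = n ↔ (X ω ∩ A).encard = n
    rw [← hω.cast_ncard_eq]
    simp
  have h1 : ∫⁻ ω, ((X ω ∩ A).encard : ℝ≥0∞) ∂P = ∫⁻ n, (n : ℝ≥0∞) ∂(poissonMeasure r) := by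
    rw [← hmap, lintegral_map (measurable_of_countable _) hgm]
    refine lintegral_congr_ae ?_
    filter_upwards [hfin] with ω hω
    simp only [hg]
    rw [← hω.cast_ncard_eq]
    simp
  have hint : Integrable (fun n : ℕ => (n : ℝ)) (poissonMeasure r) := by
    rw [integrable_poissonMeasure_iff, ← summable_nat_add_iff 1]
    have h2 := (hasSum_one_poissonMeasure r).summable.mul_left (r : ℝ)
    refine h2.congr fun n => ?_
    rw [Nat.factorial_succ, Real.norm_of_nonneg (by positivity)]
    push_cast
    field_simp
    ring
  have h3 := hint.lintegral_lt_top
  simp only [ENNReal.ofReal_natCast] at h3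
  rw [h1]
  exact h3.ne

end IsPoissonPointProcess

end Poisson

/-! ### The request process -/

section Requests

variable {Ω : Type*} [MeasurableSpace Ω] {P : Measure Ω} {M N K : ℕ} {C : Fin N → Set Plane}
  {lam : Fin M → ℝ≥0} {Q : Fin M → Ω → Set (Plane × ℝ)}

theorem measure_iUnion_cells_ne_top (hC : ∀ j, volume (C j) ≠ ∞) : volume (⋃ j, C j) ≠ ∞ :=
  ((measure_iUnion_fintype_le _ _).trans_lt (ENNReal.sum_lt_top.2 fun j _ => (hC j).lt_top)).ne

theorem measureReal_requestIntensity (hC : ∀ j, MeasurableSet (C j)) (l : ℝ≥0) (D : Set Plane)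
    {a b : ℝ} (ha : 0 ≤ a) (hab : a ≤ b) :
    (l • ((volume.restrict (⋃ j, C j)).prod (volume.restrict (Set.Ioi (0 : ℝ))))).real
      (D ×ˢ Set.Ioc a b) = l * volume.real (D ∩ ⋃ j, C j) * (b - a) := by
  have hU : MeasurableSet (⋃ j, C j) := .iUnion hC
  rw [measureReal_nnreal_smul_apply, measureReal_prod_prod, measureReal_restrict_apply' hU,
    measureReal_restrict_apply' measurableSet_Ioi,
    Set.inter_eq_left.2 (show Set.Ioc a b ⊆ Set.Ioi 0 from fun s hs => ha.trans_lt hs.1), Real.volume_real_Ioc_of_le hab, mul_assoc]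

theorem requestIntensity_ne_top (hC : ∀ j, MeasurableSet (C j)) (hC' : ∀ j, volume (C j) ≠ ∞)
    (l : ℝ≥0) (D : Set Plane) (a b : ℝ) :
    (l • ((volume.restrict (⋃ j, C j)).prod (volume.restrict (Set.Ioi (0 : ℝ)))))
      (D ×ˢ Set.Ioc a b) ≠ ∞ := by
  have hU : MeasurableSet (⋃ j, C j) := .iUnion hC
  rw [Measure.smul_apply, Measure.prod_prod, Measure.restrict_apply' hU,
    Measure.restrict_apply' measurableSet_Ioi]
  refine ENNReal.mul_ne_top ENNReal.coe_ne_top (ENNReal.mul_ne_top ?_ ?_)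
  · exact ((measure_mono Set.inter_subset_right).trans_lt
      (measure_iUnion_cells_ne_top hC').lt_top).ne
  · exact ((measure_mono Set.inter_subset_left).trans_lt measure_Ioc_lt_top).ne

namespace IsRequestProcess

theorem measureReal_no_request [IsProbabilityMeasure P] (hQ : IsRequestProcess P C lam Q)
    (hC : ∀ j, MeasurableSet (C j)) (hC' : ∀ j, volume (C j) ≠ ∞) (i : Fin M) {D : Set Plane}
    (hD : MeasurableSet D) {a b : ℝ} (ha : 0 ≤ a) (hab : a ≤ b) :
    P.real {ω | Q i ω ∩ D ×ˢ Set.Ioc a b = ∅} =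
      Real.exp (-(lam i * volume.real (D ∩ ⋃ j, C j) * (b - a))) := by
  rw [(hQ.poisson i).measureReal_inter_eq_empty (hD.prod measurableSet_Ioc)
    (requestIntensity_ne_top hC hC' _ _ _ _), measureReal_requestIntensity hC _ _ ha hab]

theorem measureReal_request_le [IsProbabilityMeasure P] (hQ : IsRequestProcess P C lam Q)
    (hC : ∀ j, MeasurableSet (C j)) (hC' : ∀ j, volume (C j) ≠ ∞) (i : Fin M)
    {a b : ℝ} (ha : 0 ≤ a) (hab : a ≤ b) :
    P.real {ω | Q i ω ∩ Set.univ ×ˢ Set.Ioc a b ≠ ∅} ≤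
      lam i * volume.real (⋃ j, C j) * (b - a) := by
  have := (hQ.poisson i).measureReal_inter_ne_empty_le (MeasurableSet.univ.prod measurableSet_Ioc)
    (requestIntensity_ne_top hC hC' (lam i) Set.univ a b)
  rwa [measureReal_requestIntensity hC _ _ ha hab, Set.univ_inter] at this

theorem ae_eq_empty [IsProbabilityMeasure P] (hQ : IsRequestProcess P C lam Q) {i : Fin M}
    (hi : lam i = 0) : ∀ᵐ ω ∂P, Q i ω = ∅ := by
  have := (hQ.poisson i).ae_inter_eq_empty MeasurableSet.univ (by simp [hi])
  simpa using this

/-- Almost surely there are finitely many requests in bounded time. -/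
theorem ae_finite [IsProbabilityMeasure P] (hQ : IsRequestProcess P C lam Q)
    (hC : ∀ j, MeasurableSet (C j)) (hC' : ∀ j, volume (C j) ≠ ∞) :
    ∀ᵐ ω ∂P, ∀ t : ℝ, ({s | ∃ i, ∃ p ∈ Q i ω, p.2 = s} ∩ Set.Ioc 0 t).Finite := by
  have h1 : ∀ᵐ ω ∂P, ∀ (i : Fin M) (n : ℕ),
      (Q i ω ∩ Set.univ ×ˢ Set.Ioc (0 : ℝ) n).Finite := by
    rw [ae_all_iff]
    intro i
    rw [ae_all_iff]
    intro n
    exact (hQ.poisson i).ae_finite_inter (MeasurableSet.univ.prod measurableSet_Ioc)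
      (requestIntensity_ne_top hC hC' _ _ _ _)
  filter_upwards [h1] with ω hω t
  obtain ⟨n, hn⟩ := exists_nat_ge t
  refine (Set.finite_iUnion fun i => (hω i n).image Prod.snd).subset ?_
  rintro s ⟨⟨i, p, hp, rfl⟩, hs⟩
  exact Set.mem_iUnion.2 ⟨i, p, ⟨hp, trivial, hs.1, hs.2.trans hn⟩, rfl⟩

theorem lintegral_numHits_ne_top [IsProbabilityMeasure P] (hQ : IsRequestProcess P C lam Q)
    (hC : ∀ j, MeasurableSet (C j)) (hC' : ∀ j, volume (C j) ≠ ∞) (B : Config M N K) :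
    ∫⁻ ω, (numHits C Q B ω : ℝ≥0∞) ∂P ≠ ∞ := by
  have hA : MeasurableSet ((Set.univ : Set Plane) ×ˢ Set.Ioc (0 : ℝ) 1) :=
    MeasurableSet.univ.prod measurableSet_Ioc
  have h1 : ∀ ω, (numHits C Q B ω : ℝ≥0∞) ≤
      ∑ i, ((Q i ω ∩ Set.univ ×ˢ Set.Ioc (0 : ℝ) 1).encard : ℝ≥0∞) := by
    intro ω
    have h2 : numHits C Q B ω ≤ ∑ i, (Q i ω ∩ Set.univ ×ˢ Set.Ioc (0 : ℝ) 1).encard := by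
      refine Finset.sum_le_sum fun i _ => Set.encard_le_encard ?_
      rintro p ⟨hp, ht, -⟩
      exact ⟨hp, trivial, ht⟩
    refine (ENat.toENNReal_le.2 h2).trans_eq ?_
    exact map_sum ENat.toENNRealRingHom _ _
  refine ((lintegral_mono h1).trans_lt ?_).ne
  have h3 : ∀ i, Measurable fun ω =>
      ((Q i ω ∩ Set.univ ×ˢ Set.Ioc (0 : ℝ) 1).encard : ℝ≥0∞) := fun i =>
    (measurable_of_countable ENat.toENNReal).comp ((hQ.poisson i).measurable_count _ hA)
  rw [lintegral_finsetSum _ fun i _ => h3 i]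
  exact ENNReal.sum_lt_top.2 fun i _ => ((hQ.poisson i).lintegral_count_ne_top hA
    (requestIntensity_ne_top hC hC' _ _ _ _)).lt_top

/-- Only the contents that are requested at all matter for the hit rate. -/
theorem hitRate_le_hitRate [IsProbabilityMeasure P] (hQ : IsRequestProcess P C lam Q)
    (hC : ∀ j, MeasurableSet (C j)) (hC' : ∀ j, volume (C j) ≠ ∞) {A B : Config M N K}
    (hAB : ∀ i j, lam i ≠ 0 → A.Has i j → B.Has i j) : hitRate P C Q A ≤ hitRate P C Q B := by
  refine ENNReal.toReal_mono (hQ.lintegral_numHits_ne_top hC hC' B) (lintegral_mono_ae ?_)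
  have h0 : ∀ᵐ ω ∂P, ∀ i, lam i = 0 → Q i ω = ∅ := by
    rw [ae_all_iff]
    intro i
    by_cases hi : lam i = 0
    · filter_upwards [hQ.ae_eq_empty hi] with ω hω _ using hω
    · exact .of_forall fun ω h => absurd h hi
  filter_upwards [h0] with ω hω
  refine ENat.toENNReal_le.2 (Finset.sum_le_sum fun i _ => Set.encard_le_encard ?_)
  rintro p ⟨hp, ht, j, hj, hij⟩
  refine ⟨hp, ht, j, hj, hAB i j (fun hi => ?_) hij⟩
  rw [hω i hi] at hp
  exact hp

end IsRequestProcess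

end Requests

/-! ### The real caches follow the virtual caches -/

section RealCaches

open Config

variable {M N K : ℕ} {C : Fin N → Set Plane}

/-- The evicted content is never one that `v` places at the serving base station. -/
theorem ServeStep.has_of_has {v r r' : Config M N K} {i₀ : Fin M} {x : Plane}
    (hs : ServeStep C v i₀ x r r') {i : Fin M} {j : Fin N} (hv : v.Has i j) (hr : r.Has i j) :
    r'.Has i j := by
  obtain ⟨n, -, -, ⟨-, rfl⟩ | ⟨-, k, -, -, hkv, hoff, heq⟩⟩ := hs
  · exact hr
  · by_cases hjn : j = n
    · subst hjn
      have : i ≠ k := by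
        rintro rfl
        exact hkv hv
      simp only [Has, heq, Finset.mem_insert, Finset.mem_erase]
      exact Or.inr ⟨this, hr⟩
    · rw [Has, hoff j hjn]
      exact hr

/-- Only `j` can serve the request, and `v` wants the content there, so it is either present already
or stored now. -/
theorem ServeStep.has_of_own_request {v r r' : Config M N K} {i : Fin M} {x : Plane} {j : Fin N}
    (hs : ServeStep C v i x r r') (hx : ∀ n, x ∈ C n → n = j) (hv : v.Has i j) :
    r'.Has i j := by
  obtain ⟨n, hn, -, hcase⟩ := hs
  obtain rfl := hx n hn
  rcases hcase with ⟨hr | hr, rfl⟩ | ⟨-, k, -, -, -, -, heq⟩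
  · exact hr
  · exact absurd hv hr
  · simp [Has, heq]

/-- A property of a jump path that is preserved at each of its locally finitely many jumps is
preserved. -/
theorem invariant_of_jumps {α : Type*} {x : ℝ → α} {Z : Set ℝ} {p : α → Prop} {a c : ℝ}
    (hfin : (Z ∩ Set.Ioc a c).Finite)
    (hconst : ∀ s t, a ≤ s → s ≤ t → (∀ z ∈ Z, z ∉ Set.Ioc s t) → x t = x s)
    (hjump : ∀ z ∈ Z, z ∈ Set.Ioc a c → ∃ r, (∀ᶠ s in 𝓝[<] z, x s = r) ∧ (p r → p (x z)))
    (ha : p (x a)) : ∀ b, a ≤ b → b ≤ c → p (x b) := by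
  suffices H : ∀ n : ℕ, ∀ b, a ≤ b → b ≤ c → (Z ∩ Set.Ioc a b).ncard = n → p (x b) from
    fun b h1 h2 => H _ b h1 h2 rfl
  intro n
  induction n using Nat.strong_induction_on with
  | _ n ih =>
    intro b hab hbc hn
    have hfb : (Z ∩ Set.Ioc a b).Finite :=
      hfin.subset (Set.inter_subset_inter_right _ (Set.Ioc_subset_Ioc_right hbc))
    rcases (Z ∩ Set.Ioc a b).eq_empty_or_nonempty with hemp | hne
    · rw [hconst a b le_rfl hab fun z hz hzab => by
        have : z ∈ Z ∩ Set.Ioc a b := ⟨hz, hzab⟩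
        rw [hemp] at this
        exact this]
      exact ha
    · obtain ⟨z, ⟨hzZ, hz⟩, hmax⟩ := hfb.exists_maximal hne
      have hxb : x b = x z := by
        refine hconst z b hz.1.le hz.2 fun y hy hyz => ?_
        exact (hmax ⟨hy, hz.1.trans hyz.1, hyz.2⟩ hyz.1.le).not_gt hyz.1
      obtain ⟨r, hr, hp⟩ := hjump z hzZ ⟨hz.1, hz.2.trans hbc⟩
      have hev : ∀ᶠ s in 𝓝[<] z, s ∈ Set.Ioo a z := Ioo_mem_nhdsLT hz.1
      obtain ⟨s, hsr, hs⟩ := (hr.and hev).exists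
      rw [hxb]
      refine hp ?_
      rw [← hsr]
      refine ih _ ?_ s hs.1.le (hs.2.le.trans (hz.2.trans hbc)) rfl
      rw [← hn]
      refine Set.ncard_lt_ncard (Set.ssubset_iff_of_subset ?_ |>.2 ⟨z, ⟨hzZ, hz⟩, ?_⟩) hfb
      · exact Set.inter_subset_inter_right _ (Set.Ioc_subset_Ioc_right (hs.2.le.trans hz.2))
      · exact fun h => (h.2.2.trans_lt hs.2).false

theorem epoch_succ (T : ℕ → ℝ) (l : ℕ) : epoch T (l + 1) = epoch T l + T l :=
  Finset.sum_range_succ _ _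

theorem strictMono_epoch {T : ℕ → ℝ} (hT : ∀ k, 0 < T k) : StrictMono (epoch T) :=
  strictMono_nat_of_lt_succ fun l => by rw [epoch_succ]; linarith [hT l]

theorem epoch_nonneg {T : ℕ → ℝ} (hT : ∀ k, 0 < T k) (l : ℕ) : 0 ≤ epoch T l :=
  Finset.sum_nonneg fun k _ => (hT k).le

theorem lastEpoch_eq {T : ℕ → ℝ} (hT : ∀ k, 0 < T k) {l : ℕ} {s : ℝ} (h1 : epoch T l ≤ s)
    (h2 : s < epoch T (l + 1)) : lastEpoch T s = epoch T l := by
  have : IsGreatest {l : ℕ | epoch T l ≤ s} l :=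
    ⟨h1, fun k hk => Nat.lt_succ_iff.1 ((strictMono_epoch hT).lt_iff_lt.1 (lt_of_le_of_lt hk h2))⟩
  rw [lastEpoch, this.csSup_eq]

variable {Ω : Type*} [MeasurableSpace Ω] {P : Measure Ω} [IsProbabilityMeasure P]
  {lam : Fin M → ℝ≥0} {Q : Fin M → Ω → Set (Plane × ℝ)} {V : ℕ → Ω → Config M N K} {T : ℕ → ℝ}
  {R : ℝ → Ω → Config M N K}

/-- A content that the virtual placement of the current epoch puts at base station `j`, and that has
been requested during the epoch from a point that only `j` covers, is in the real cache of `j`. -/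
theorem IsRealCacheProcess.ae_has (hR : IsRealCacheProcess P C Q V T R)
    (hQ : IsRequestProcess P C lam Q) (hC : ∀ j, MeasurableSet (C j))
    (hC' : ∀ j, volume (C j) ≠ ∞) (hT : ∀ k, 0 < T k) :
    ∀ᵐ ω ∂P, ∀ l τ, τ < epoch T (l + 1) → ∀ i j,
      (virtualBefore V (epoch T l) ω).Has i j →
      Q i ω ∩ (C j ∩ (⋃ n, ⋃ (_ : n ≠ j), C n)ᶜ) ×ˢ Set.Ioc (epoch T l) τ ≠ ∅ →
      (R τ ω).Has i j := by
  filter_upwards [hR.const, hR.serve, hQ.ae_finite hC hC'] with ω hconst hserve hfin l τ hτ i j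
    hv hne
  obtain ⟨p, hp, ⟨-, hpD⟩, hpt⟩ := Set.nonempty_iff_ne_empty.2 hne
  have hl := epoch_nonneg hT l
  have hown : ∀ n, p.1 ∈ C n → n = j := by
    intro n hn
    by_contra hnj
    exact hpD (Set.mem_iUnion₂.2 ⟨n, hnj, hn⟩)
  have hbase : (R p.2 ω).Has i j := by
    obtain ⟨r, -, hs⟩ := hserve i p hp
    rw [lastEpoch_eq hT hpt.1.le (hpt.2.trans_lt hτ)] at hs
    exact hs.has_of_own_request hown hv
  refine invariant_of_jumps (x := fun s => R s ω) (Z := {s | ∃ i, ∃ p ∈ Q i ω, p.2 = s})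
    (p := fun r => r.Has i j) (a := p.2) (c := τ) ?_ ?_ ?_ hbase τ hpt.2 le_rfl
  · exact (hfin τ).subset (Set.inter_subset_inter_right _
      (Set.Ioc_subset_Ioc_left (hl.trans hpt.1.le)))
  · intro s t hs hst hz
    exact hconst s t ((hl.trans hpt.1.le).trans hs) hst fun i q hq => hz _ ⟨i, q, hq, rfl⟩
  · rintro z ⟨i', q, hq, rfl⟩ hz
    obtain ⟨r, hr, hs⟩ := hserve i' q hq
    rw [lastEpoch_eq hT (hpt.1.le.trans hz.1.le) (hz.2.trans_lt hτ)] at hs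
    exact ⟨r, hr, hs.has_of_has hv⟩

/-- The probability that the real caches are not optimal some time after the start of an epoch. -/
theorem IsRealCacheProcess.measureReal_notMem_optimalConfigs_le
    (hR : IsRealCacheProcess P C Q V T R) (hQ : IsRequestProcess P C lam Q)
    (hC : ∀ j, MeasurableSet (C j)) (hC' : ∀ j, volume (C j) ≠ ∞) (hT : ∀ k, 0 < T k)
    {l : ℕ} {τ : ℝ} (h1 : epoch T l ≤ τ) (h2 : τ < epoch T (l + 1)) :
    P.real {ω | R τ ω ∉ optimalConfigs (hitRate P C Q)} ≤
      P.real {ω | virtualBefore V (epoch T l) ω ∉ optimalConfigs (hitRate P C Q)} +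
        ∑ i with lam i ≠ 0, ∑ j, Real.exp (-(lam i *
          volume.real (C j ∩ (⋃ n, ⋃ (_ : n ≠ j), C n)ᶜ) * (τ - epoch T l))) := by
  classical
  have hD : ∀ j, MeasurableSet (C j ∩ (⋃ n, ⋃ (_ : n ≠ j), C n)ᶜ) := fun j =>
    (hC j).inter (.compl (.iUnion fun n => .iUnion fun _ => hC n))
  have hsub : ∀ᵐ ω ∂P, ω ∈ {ω | R τ ω ∉ optimalConfigs (hitRate P C Q)} →
      ω ∈ {ω | virtualBefore V (epoch T l) ω ∉ optimalConfigs (hitRate P C Q)} ∪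
        ⋃ i ∈ Finset.univ.filter fun i => lam i ≠ 0, ⋃ j,
          {ω | Q i ω ∩ (C j ∩ (⋃ n, ⋃ (_ : n ≠ j), C n)ᶜ) ×ˢ Set.Ioc (epoch T l) τ = ∅} := by
    filter_upwards [hR.ae_has hQ hC hC' hT] with ω hω hRω
    by_contra hnot
    simp only [Set.mem_union, Set.mem_iUnion, Finset.mem_filter, Finset.mem_univ, true_and,
      Set.mem_ofPred_eq, not_or, not_not, not_exists] at hnot
    -- With `v` optimal and no exclusive request missing, `R τ` contains all that `v` stores among
    -- the contents of positive intensity, so its hit rate is at least that of `v`.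
    refine hRω fun B => (hnot.1 B).trans (hQ.hitRate_le_hitRate hC hC' fun i j hi hij => ?_)
    exact hω l τ h2 i j hij (hnot.2 i hi j)
  refine (ENNReal.toReal_mono (measure_ne_top _ _) (measure_mono_ae hsub)).trans ?_
  refine (measureReal_union_le _ _).trans (add_le_add le_rfl ?_)
  refine (measureReal_biUnion_finset_le _ _).trans (Finset.sum_le_sum fun i _ => ?_)
  refine (measureReal_iUnion_fintype_le _).trans (Finset.sum_le_sum fun j _ => ?_)
  rw [hQ.measureReal_no_request hC hC' i (hD j) (epoch_nonneg hT l) h1, Set.inter_eq_left.2]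
  exact Set.inter_subset_left.trans (Set.subset_iUnion C j)

/-- The real caches are unlikely to change in a short time. -/
theorem IsRealCacheProcess.measureReal_ne_le (hR : IsRealCacheProcess P C Q V T R)
    (hQ : IsRequestProcess P C lam Q) (hC : ∀ j, MeasurableSet (C j))
    (hC' : ∀ j, volume (C j) ≠ ∞) {a b : ℝ} (ha : 0 ≤ a) (hab : a ≤ b) :
    P.real {ω | R a ω ≠ R b ω} ≤ (∑ i, lam i * volume.real (⋃ j, C j)) * (b - a) := by
  have hsub : ∀ᵐ ω ∂P, ω ∈ {ω | R a ω ≠ R b ω} →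
      ω ∈ ⋃ i, {ω | Q i ω ∩ Set.univ ×ˢ Set.Ioc a b ≠ ∅} := by
    filter_upwards [hR.const] with ω hω hne
    by_contra hnot
    simp only [Set.mem_iUnion, Set.mem_ofPred_eq, not_exists, not_not] at hnot
    refine hne (hω a b ha hab fun i p hp hpt => ?_).symm
    have : p ∈ Q i ω ∩ Set.univ ×ˢ Set.Ioc a b := ⟨hp, trivial, hpt⟩
    rw [hnot i] at this
    exact this
  refine (ENNReal.toReal_mono (measure_ne_top _ _) (measure_mono_ae hsub)).trans ?_
  refine (measureReal_iUnion_fintype_le _).trans ?_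
  rw [Finset.sum_mul]
  exact Finset.sum_le_sum fun i _ => hQ.measureReal_request_le hC hC' i ha hab

/-- The caches change only at requests, so the probability is Lipschitz with the total request rate
as constant. This makes the time integrals meaningful. -/
theorem IsRealCacheProcess.continuousOn_measureReal_mem (hR : IsRealCacheProcess P C Q V T R)
    (hQ : IsRequestProcess P C lam Q) (hC : ∀ j, MeasurableSet (C j))
    (hC' : ∀ j, volume (C j) ≠ ∞) (S : Set (Config M N K)) :
    ContinuousOn (fun τ => P.real {ω | R τ ω ∈ S}) (Set.Ici 0) := by
  set L : ℝ := ∑ i, lam i * volume.real (⋃ j, C j)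
  have hL : 0 ≤ L := by positivity
  have hmono : ∀ a b : ℝ, P.real {ω | R a ω ∈ S} ≤
      P.real {ω | R b ω ∈ S} + P.real {ω | R a ω ≠ R b ω} := by
    intro a b
    refine (measureReal_mono ?_ (measure_ne_top _ _)).trans (measureReal_union_le _ _)
    intro ω hω
    by_cases hab : R a ω = R b ω
    · exact Or.inl (show R b ω ∈ S from hab ▸ hω)
    · exact Or.inr hab
  have hsymm : ∀ a b : ℝ, {ω | R a ω ≠ R b ω} = {ω | R b ω ≠ R a ω} := fun a b => by
    ext ω; exact ne_comm
  have hlip : ∀ a b : ℝ, 0 ≤ a → a ≤ b →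
      |P.real {ω | R a ω ∈ S} - P.real {ω | R b ω ∈ S}| ≤ L * |a - b| := by
    intro a b ha hab
    have h1 := hR.measureReal_ne_le hQ hC hC' ha hab
    have h2 := hmono a b
    have h3 := hmono b a
    rw [hsymm b a] at h3
    rw [abs_sub_comm a b, abs_of_nonneg (sub_nonneg.2 hab), abs_le]
    constructor <;> linarith
  refine LipschitzOnWith.continuousOn (K := L.toNNReal) (.of_dist_le_mul fun a ha b hb => ?_)
  rw [Real.coe_toNNReal _ hL, Real.dist_eq, Real.dist_eq]
  rcases le_total a b with hab | hab
  · exact hlip a b ha hab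
  · rw [abs_sub_comm, abs_sub_comm a b]
    exact hlip b a hb hab

end RealCaches

/-! ### Averages over time -/

section Averages

variable {T : ℕ → ℝ}

theorem tendsto_epoch_atTop (hT : ∀ k, 0 < T k) (hlim : Tendsto T atTop atTop) :
    Tendsto (epoch T) atTop atTop := by
  refine (not_summable_iff_tendsto_nat_atTop_of_nonneg fun k => (hT k).le).1 fun hsum => ?_
  exact not_tendsto_nhds_of_tendsto_atTop hlim 0 hsum.tendsto_atTop_zero

theorem exists_epoch_le_lt (hT : ∀ k, 0 < T k) (hlim : Tendsto T atTop atTop) {t : ℝ}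
    (ht : 0 ≤ t) : ∃ l, epoch T l ≤ t ∧ t < epoch T (l + 1) := by
  classical
  have hex : ∃ l, t < epoch T l := ((tendsto_epoch_atTop hT hlim).eventually_gt_atTop t).exists
  have h0 : Nat.find hex ≠ 0 := by
    intro h
    have h1 := Nat.find_spec hex
    rw [h, epoch, Finset.sum_range_zero] at h1
    linarith
  obtain ⟨l, hl⟩ := Nat.exists_eq_succ_of_ne_zero h0
  refine ⟨l, not_lt.1 (Nat.find_min hex (by omega)), ?_⟩
  have h1 := Nat.find_spec hex
  rwa [hl] at h1

/-- A bounded function that becomes small a fixed time after the start of each late epoch has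
vanishing time averages, since the durations of the epochs tend to infinity. -/
theorem tendsto_average_zero (hT : ∀ k, 0 < T k) (hlim : Tendsto T atTop atTop) {g : ℝ → ℝ}
    (hg : ContinuousOn g (Set.Ici 0)) (hg0 : ∀ τ, 0 ≤ g τ) (hg1 : ∀ τ, g τ ≤ 1)
    (hsmall : ∀ ε > 0, ∃ L : ℝ, 0 ≤ L ∧ ∃ l₀, ∀ l ≥ l₀, ∀ τ, epoch T l + L ≤ τ →
      τ < epoch T (l + 1) → g τ ≤ ε) :
    Tendsto (fun t : ℝ => (∫ τ in (0 : ℝ)..t, g τ) / t) atTop (𝓝 0) := by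
  have hint : ∀ a b : ℝ, 0 ≤ a → 0 ≤ b → IntervalIntegrable g volume a b := fun a b ha hb =>
    (hg.mono fun x hx => (le_min ha hb).trans hx.1).intervalIntegrable
  have hle : ∀ a b c : ℝ, 0 ≤ a → a ≤ b → (∀ τ ∈ Set.Ioo a b, g τ ≤ c) →
      ∫ τ in a..b, g τ ≤ c * (b - a) := by
    intro a b c ha hab hc
    have := intervalIntegral.integral_mono_on_of_le_Ioo hab (hint a b ha (ha.trans hab))
      intervalIntegrable_const hc
    rwa [intervalIntegral.integral_const, smul_eq_mul, mul_comm] at this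
  rw [Metric.tendsto_atTop]
  intro ε hε
  obtain ⟨L, hL, l₀, hl₀⟩ := hsmall (ε / 4) (by positivity)
  -- From `l₁` on, the initial stretch `L` is at most a fraction `ε / 4` of the epoch. With the `ε /
  -- 4` from the remainder, complete epochs cost `ε / 2` per unit time.
  obtain ⟨l₁, hl₁⟩ := eventually_atTop.1 ((hlim.eventually_ge_atTop (L / (ε / 4))).and
    (eventually_ge_atTop l₀))
  have hS := epoch_nonneg hT
  have hwithin : ∀ l ≥ l₁, ∀ t, epoch T l ≤ t → t ≤ epoch T (l + 1) →
      ∫ τ in epoch T l..t, g τ ≤ L + ε / 4 * (t - epoch T l) := by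
    intro l hl t h1 h2
    set m := min t (epoch T l + L) with hm
    have hm1 : epoch T l ≤ m := le_min h1 (by linarith)
    have hm2 : m ≤ t := min_le_left _ _
    have hm3 : m ≤ epoch T l + L := min_le_right _ _
    rw [← intervalIntegral.integral_add_adjacent_intervals
      (hint (epoch T l) m (hS l) ((hS l).trans hm1))
      (hint m t ((hS l).trans hm1) ((hS l).trans h1))]
    have h3 := hle (epoch T l) m 1 (hS l) hm1 fun τ _ => hg1 τ
    have h4 := hle m t (ε / 4) ((hS l).trans hm1) hm2 fun τ hτ => by
      refine hl₀ l (hl₁ l hl).2 τ ?_ (hτ.2.trans_le h2)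
      rcases min_lt_iff.1 hτ.1 with h | h
      · exact absurd h hτ.2.not_gt
      · exact h.le
    have h5 : ε / 4 * (t - m) ≤ ε / 4 * (t - epoch T l) := by gcongr
    linarith
  have hends : ∀ k, ∫ τ in (0 : ℝ)..epoch T (l₁ + k), g τ ≤
      epoch T l₁ + ε / 2 * epoch T (l₁ + k) := by
    intro k
    induction k with
    | zero =>
      have := hle 0 (epoch T l₁) 1 le_rfl (hS l₁) fun τ _ => hg1 τ
      have : 0 ≤ ε / 2 * epoch T l₁ := mul_nonneg (by positivity) (hS l₁)
      simp only [add_zero]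
      linarith
    | succ k ih =>
      have h1 : epoch T (l₁ + k) ≤ epoch T (l₁ + k + 1) :=
        (strictMono_epoch hT).monotone (Nat.le_succ _)
      rw [← add_assoc, ← intervalIntegral.integral_add_adjacent_intervals
        (hint 0 _ le_rfl (hS (l₁ + k))) (hint _ _ (hS (l₁ + k)) (hS (l₁ + k + 1)))]
      have h2 := hwithin (l₁ + k) (Nat.le_add_right _ _) _ h1 le_rfl
      have h3 := (div_le_iff₀ (by positivity)).1 (hl₁ (l₁ + k) (Nat.le_add_right _ _)).1
      have h4 := epoch_succ T (l₁ + k)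
      rw [h4] at h2 ⊢
      linarith
  -- The threshold absorbs the time before epoch `l₁` and the stretch `L` of the unfinished last
  -- epoch into another `ε / 4 * t`.
  refine ⟨max (epoch T l₁) (max 1 ((epoch T l₁ + L) / (ε / 4))), fun t ht => ?_⟩
  have ht1 : epoch T l₁ ≤ t := (le_max_left _ _).trans ht
  have ht2 : 1 ≤ t := ((le_max_left _ _).trans (le_max_right _ _)).trans ht
  have ht3 : (epoch T l₁ + L) / (ε / 4) ≤ t :=
    ((le_max_right _ _).trans (le_max_right _ _)).trans ht
  have ht0 : 0 < t := by linarith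
  obtain ⟨l, h1, h2⟩ := exists_epoch_le_lt hT hlim ht0.le
  have hl : l₁ ≤ l :=
    Nat.lt_succ_iff.1 ((strictMono_epoch hT).lt_iff_lt.1 (ht1.trans_lt h2))
  obtain ⟨k, rfl⟩ := Nat.exists_eq_add_of_le hl
  have h3 := hends k
  have h4 := hwithin _ hl t h1 h2.le
  have h5 : ∫ τ in (0 : ℝ)..t, g τ =
      (∫ τ in (0 : ℝ)..epoch T (l₁ + k), g τ) + ∫ τ in epoch T (l₁ + k)..t, g τ :=
    (intervalIntegral.integral_add_adjacent_intervals
      (hint _ _ le_rfl (hS _)) (hint _ _ (hS _) ht0.le)).symm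
  have h6 : 0 ≤ ∫ τ in (0 : ℝ)..t, g τ :=
    intervalIntegral.integral_nonneg ht0.le fun τ _ => hg0 τ
  have h7 := (div_le_iff₀ (by positivity)).1 ht3
  rw [Real.dist_eq, sub_zero, abs_of_nonneg (div_nonneg h6 ht0.le), div_lt_iff₀ ht0, h5]
  have h8 : 0 < ε / 4 * t := by positivity
  have h9 : 0 ≤ ε / 4 * (t - epoch T (l₁ + k)) :=
    mul_nonneg (by positivity) (sub_nonneg.2 h1)
  linarith

end Averages

/-! ### Convergence of the real caches -/

section Convergence

variable {Ω : Type*} [MeasurableSpace Ω] {P : Measure Ω} {M N K : ℕ}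

theorem optimalConfigs_eq_of_mem {h : Config M N K → ℝ} {B : Config M N K}
    (hB : B ∈ optimalConfigs h) : h B = ⨆ B, h B :=
  have : Nonempty (Config M N K) := ⟨B⟩
  (le_ciSup_config h B).antisymm (ciSup_le hB)

theorem integral_config_eq_sum [IsProbabilityMeasure P] (h : Config M N K → ℝ) {X : Ω → Config M N K}
    (hX : Measurable X) : ∫ ω, h (X ω) ∂P = ∑ B, P.real {ω | X ω = B} * h B := by
  rw [← integral_map hX.aemeasurable (measurable_of_finite h).aestronglyMeasurable]
  have := Measure.isProbabilityMeasure_map (μ := P) hX.aemeasurable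
  rw [integral_fintype .of_finite]
  refine Finset.sum_congr rfl fun B _ => ?_
  rw [map_measureReal_apply hX .of_discrete, smul_eq_mul]
  rfl

/-- Only non-optimal values contribute to the deficit, each by at most the range of `h`. -/
theorem ciSup_sub_integral_mem_Icc [IsProbabilityMeasure P] (h : Config M N K → ℝ) {X : Ω → Config M N K}
    (hX : Measurable X) : (⨆ B, h B) - ∫ ω, h (X ω) ∂P ∈
      Set.Icc 0 (((⨆ B, h B) - ⨅ B, h B) * P.real {ω | X ω ∉ optimalConfigs h}) := by
  have h1 : (⨆ B, h B) - ∫ ω, h (X ω) ∂P =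
      ∑ B, P.real {ω | X ω = B} * ((⨆ B, h B) - h B) := by
    simp only [mul_sub, Finset.sum_sub_distrib, ← Finset.sum_mul]
    rw [sum_measureReal_eq_one hX, one_mul, integral_config_eq_sum h hX]
  rw [h1]
  refine ⟨Finset.sum_nonneg fun B _ =>
    mul_nonneg measureReal_nonneg (sub_nonneg.2 (le_ciSup_config h B)), ?_⟩
  rw [← sum_measureReal_inter_eq hX, Finset.mul_sum]
  refine Finset.sum_le_sum fun B _ => ?_
  by_cases hB : B ∈ optimalConfigs h
  · rw [optimalConfigs_eq_of_mem hB, sub_self, mul_zero]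
    refine mul_nonneg (sub_nonneg.2 ?_) measureReal_nonneg
    exact (ciInf_config_le h B).trans (le_ciSup_config h B)
  · have : {ω | X ω ∉ optimalConfigs h} ∩ {ω | X ω = B} = {ω | X ω = B} :=
      Set.inter_eq_right.2 fun ω (hω : X ω = B) => show X ω ∉ _ from hω ▸ hB
    rw [this, mul_comm]
    refine mul_le_mul_of_nonneg_right ?_ measureReal_nonneg
    linarith [ciInf_config_le h B]

theorem tendsto_virtualBefore_epoch {V : ℕ → Ω → Config M N K} {S : Set (Config M N K)}
    (hV : Tendsto (fun t => P.real {ω | V t ω ∈ S}) atTop (𝓝 0)) {T : ℕ → ℝ}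
    (hT : ∀ k, 0 < T k) (hlim : Tendsto T atTop atTop) :
    Tendsto (fun l => P.real {ω | virtualBefore V (epoch T l) ω ∈ S}) atTop (𝓝 0) :=
  hV.comp ((tendsto_sub_atTop_nat 1).comp
    (tendsto_nat_ceil_atTop.comp (tendsto_epoch_atTop hT hlim)))

end Convergence

theorem theorem4 {Ω : Type*} [MeasurableSpace Ω] (P : Measure Ω) [IsProbabilityMeasure P]
    (N M K : ℕ) (hK : K < M)
    (C : Fin N → Set Plane) (hC_meas : ∀ j, MeasurableSet (C j)) (hC_fin : ∀ j, volume (C j) ≠ ∞)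
    (hC_own : ∀ j, 0 < volume (C j ∩ (⋃ n, ⋃ (_ : n ≠ j), C n)ᶜ))
    (lam : Fin M → ℝ≥0) (Q : Fin M → Ω → Set (Plane × ℝ)) (hQ : IsRequestProcess P C lam Q)
    (h : Config M N K → ℝ) (hh : h = hitRate P C Q)
    (β₀ : ℝ) (hβ₀ : 0 < β₀) (hβ₀_gap : β₀ * N * ((⨆ B, h B) - ⨅ B, h B) < 1)
    (hβ₀_max : β₀ * (⨆ B, h B) < 1)
    (V : ℕ → Ω → Config M N K) (hV : IsAnnealedGibbsChain P h β₀ V)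
    (T : ℕ → ℝ) (hT_pos : ∀ k, 0 < T k) (hT_mono : Monotone T) (hT_lim : Tendsto T atTop atTop)
    (R : ℝ → Ω → Config M N K) (hR : IsRealCacheProcess P C Q V T R) :
    Tendsto (fun t : ℝ => (∫ τ in (0 : ℝ)..t, P.real {ω | R τ ω ∈ optimalConfigs h}) / t)
        atTop (𝓝 1) ∧
      Tendsto (fun t : ℝ => (∫ τ in (0 : ℝ)..t, ∫ ω, h (R τ ω) ∂P) / t)
        atTop (𝓝 (⨆ B, h B)) := by
  have hVlim : Tendsto (fun t => P.real {ω | V t ω ∈ (optimalConfigs h)ᶜ}) atTop (𝓝 0) := by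
    -- Without base stations there is a single placement, which is optimal; the annealing argument
    -- divides by `N`.
    by_cases hN : N = 0
    · subst hN
      have : (optimalConfigs h)ᶜ = ∅ := by
        refine Set.compl_empty_iff.2 (Set.eq_univ_of_forall fun B B' => le_of_eq ?_)
        rw [show B' = B from funext fun j => j.elim0]
      simp [this]
    · exact hV.tendsto_measureReal_notMem_optimalConfigs hK.le hN hβ₀ hβ₀_gap
  set g : ℝ → ℝ := fun τ => P.real {ω | R τ ω ∈ (optimalConfigs h)ᶜ} with hg
  have hcont : ∀ S, ContinuousOn (fun τ => P.real {ω | R τ ω ∈ S}) (Set.Ici 0) :=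
    hR.continuousOn_measureReal_mem hQ hC_meas hC_fin
  -- The exclusive areas are positive and finite, so each remaining exponential has a positive rate.
  have hexp : Tendsto (fun x : ℝ => ∑ i with lam i ≠ 0, ∑ j, Real.exp (-(lam i *
      volume.real (C j ∩ (⋃ n, ⋃ (_ : n ≠ j), C n)ᶜ) * x))) atTop (𝓝 0) := by
    have h0 : (0 : ℝ) = ∑ i with lam i ≠ 0, ∑ j : Fin N, 0 := by simp
    rw [h0]
    refine tendsto_finsetSum _ fun i hi => tendsto_finsetSum _ fun j _ => ?_
    refine Real.tendsto_exp_neg_atTop_nhds_zero.comp (tendsto_id.const_mul_atTop ?_)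
    have h1 : 0 < lam i := pos_iff_ne_zero.2 (Finset.mem_filter.1 hi).2
    refine mul_pos (by exact_mod_cast h1) (ENNReal.toReal_pos (hC_own j).ne' ?_)
    exact ((measure_mono Set.inter_subset_left).trans_lt (hC_fin j).lt_top).ne
  have hsmall : ∀ ε > 0, ∃ L : ℝ, 0 ≤ L ∧ ∃ l₀, ∀ l ≥ l₀, ∀ τ, epoch T l + L ≤ τ →
      τ < epoch T (l + 1) → g τ ≤ ε := by
    intro ε hε
    obtain ⟨L, hL⟩ := eventually_atTop.1 (hexp.eventually_le_const (half_pos hε))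
    obtain ⟨l₀, hl₀⟩ := eventually_atTop.1
      ((tendsto_virtualBefore_epoch hVlim hT_pos hT_lim).eventually_le_const (half_pos hε))
    refine ⟨max L 0, le_max_right _ _, l₀, fun l hl τ h1 h2 => ?_⟩
    have h3 := hL (τ - epoch T l) (by linarith [le_max_left L 0])
    have h4 := hl₀ l hl
    have h5 := hR.measureReal_notMem_optimalConfigs_le hQ hC_meas hC_fin hT_pos
      (by linarith [le_max_right L 0]) h2
    rw [← hh] at h5
    simp only [Set.mem_compl_iff] at h4
    simp only [hg, Set.mem_compl_iff]
    linarith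
  have havg := tendsto_average_zero hT_pos hT_lim (hcont _) (fun τ => measureReal_nonneg)
    (fun τ => measureReal_le_one) hsmall
  have hgint : ∀ t : ℝ, 0 ≤ t → IntervalIntegrable g volume 0 t := fun t ht =>
    ((hcont _).mono fun x hx => (le_min le_rfl ht).trans hx.1).intervalIntegrable
  constructor
  · have h1 := havg.const_sub 1
    rw [sub_zero] at h1
    refine h1.congr' ?_
    filter_upwards [eventually_gt_atTop 0] with t ht
    have h2 : ∫ τ in (0 : ℝ)..t, P.real {ω | R τ ω ∈ optimalConfigs h} =
        ∫ τ in (0 : ℝ)..t, (1 - g τ) := by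
      refine intervalIntegral.integral_congr fun τ hτ => ?_
      rw [Set.uIcc_of_le ht.le] at hτ
      have hm : MeasurableSet {ω | R τ ω ∈ optimalConfigs h} := hR.measurable τ hτ.1 .of_discrete
      have h3 := probReal_compl_eq_one_sub (μ := P) hm
      have h4 : g τ = P.real {ω | R τ ω ∈ optimalConfigs h}ᶜ := rfl
      simp only [h4, h3]
      ring
    rw [h2, intervalIntegral.integral_sub intervalIntegrable_const (hgint t ht.le),
      intervalIntegral.integral_const, sub_zero, smul_eq_mul, mul_one, sub_div, div_self ht.ne']
  · set s := ⨆ B, h B with hs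
    set E : ℝ → ℝ := fun τ => ∫ ω, h (R τ ω) ∂P with hE
    have hEcont : ContinuousOn E (Set.Ici 0) := by
      have h1 : ContinuousOn (fun τ => ∑ B, P.real {ω | R τ ω ∈ ({B} : Set _)} * h B)
          (Set.Ici 0) := continuousOn_finsetSum _ fun B _ => (hcont {B}).mul_const _
      exact h1.congr fun τ hτ => integral_config_eq_sum h (hR.measurable τ hτ)
    have hEint : ∀ t : ℝ, 0 ≤ t → IntervalIntegrable E volume 0 t := fun t ht =>
      (hEcont.mono fun x hx => (le_min le_rfl ht).trans hx.1).intervalIntegrable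
    have hmem : ∀ τ, 0 ≤ τ → s - E τ ∈ Set.Icc 0 ((s - ⨅ B, h B) * g τ) := fun τ hτ =>
      ciSup_sub_integral_mem_Icc h (hR.measurable τ hτ)
    have hdiff : Tendsto (fun t : ℝ => (∫ τ in (0 : ℝ)..t, (s - E τ)) / t) atTop (𝓝 0) := by
      have hup := havg.const_mul (s - ⨅ B, h B)
      rw [mul_zero] at hup
      refine squeeze_zero' ?_ ?_ hup
      · filter_upwards [eventually_ge_atTop 0] with t ht
        exact div_nonneg (intervalIntegral.integral_nonneg ht fun τ hτ => (hmem τ hτ.1).1) ht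
      · filter_upwards [eventually_ge_atTop 0] with t ht
        rw [← mul_div_assoc, ← intervalIntegral.integral_const_mul]
        refine div_le_div_of_nonneg_right ?_ ht
        exact intervalIntegral.integral_mono_on ht
          (intervalIntegrable_const.sub (hEint t ht)) ((hgint t ht).const_mul _)
          fun τ hτ => (hmem τ hτ.1).2
    have h1 := hdiff.const_sub s
    rw [sub_zero] at h1
    refine h1.congr' ?_
    filter_upwards [eventually_gt_atTop 0] with t ht
    rw [intervalIntegral.integral_sub intervalIntegrable_const (hEint t ht.le),
      intervalIntegral.integral_const, sub_zero, smul_eq_mul, sub_div, mul_div_cancel_left₀ _ ht.ne',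
      sub_sub_cancel]
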